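/- Let $\tau$ be in the upper half-plane, $p^{\lambda}=e^{i\pi\tau\lambda}$, and let $n\ge 1$. For $z_1,\dots,z_{2n}\in\mathbb C$ put $x_j=e^{i\pi z_j}$ and $X=x_1\cdots x_{2n}$. Let $(a;q)_\infty=\prod_{j\ge0}(1-aq^j)$, $\theta(x;q)=(x;q)_\infty(q/x;q)_\infty$, $\theta(a_1,\dots,a_m;q)=\prod_i\theta(a_i;q)$, let $\left(\frac{k}{3}\right)$ be the Legendre symbol, $\operatorname{pf}(a_{ij})=\frac1{2^nn!}\sum_{\sigma\in S_{2n}}\operatorname{sgn}(\sigma)\prod_{j=1}^n a_{\sigma(2j-1)\sigma(2j)}$, and $\chi_{\mu}(y_1,\dots,y_{2n})=\det_{1\le i,j\le 2n}(y_i^{\mu_j})$ for $\mu\in\mathbb Z^{2n}$. With $y_{ij}=x_i^2/x_j^2$ let $$\Theta=\prod_{1\le i<j\le 2n}\theta(p^{1/3}y_{ij};p^{2/3}),\quad \Theta'=\prod_{1\le i<j\le 2n}\theta(p^{3}y_{ij}^3;p^{6}),\quad \Theta''=\prod_{1\le i<j\le 2n}\frac{x_j}{x_i}\,\theta(-y_{ij};p^{2/3}),$$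 and let $$P_n^{(0)}=\Theta\,\operatorname{pf}\left(\frac{x_j^2\,\theta(y_{ij},-y_{ij},py_{ij};p^2)}{x_i^2\,\theta(p^{1/3}y_{ij};p^{2/3})}\right),\qquad P_n^{(2)}=\Theta'\,\operatorname{pf}\left(\frac{x_j\,\theta(y_{ij},py_{ij},-py_{ij};p^2)}{x_i\,\theta(p^{3}y_{ij}^3;p^{6})}\right),$$ $$P_n^{(3)}=\Theta''\,\operatorname{pf}\left(\frac{x_j\,\theta(y_{ij},-y_{ij},py_{ij};p^2)}{x_i\,\theta(-y_{ij};p^{2/3})}\right),\qquad P_n^{(4)}=\Theta'\,\operatorname{pf}\left(\frac{x_j^2\,\theta(y_{ij},-y_{ij},py_{ij};p^2)}{x_i^2\,\theta(p^{3}y_{ij}^3;p^{6})}\right),$$ $$P_n^{(6)}=\Theta\,\operatorname{pf}\left(\frac{x_j\,\theta(y_{ij},py_{ij},-py_{ij};p^2)}{x_i\,\theta(p^{1/3}y_{ij};p^{2/3})}\right)$$ (removable singularities are removed; for $|x_j|$ near $1$ they only occur for $P_n^{(3)}$ at points with $x_i^2=-x_j^2$ for some $i\neq j$, where the value is $0$).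 Let $$C_0=-\frac{(p^4;p^4)_\infty}{(p^2;p^2)_\infty^2(p^{4/3};p^{4/3})_\infty},\quad C_2=\frac{(-p;-p)_\infty}{(p^2;p^2)_\infty^2(-p^3;-p^3)_\infty},\quad C_3=\frac{(p;p)_\infty}{(p^2;p^2)_\infty^2(p^{1/3};p^{1/3})_\infty},$$ $$C_4=-\frac{(p^4;p^4)_\infty}{(p^2;p^2)_\infty^2(p^{12};p^{12})_\infty},\quad C_6=-\frac{(-p;-p)_\infty}{(p^2;p^2)_\infty^2(-p^{1/3};-p^{1/3})_\infty}.$$ Then there is an open set $U\subseteq\mathbb C^{2n}$ containing $\{|x_1|=\dots=|x_{2n}|=1\}$ such that, whenever $(x_1,\dots,x_{2n})\in U$, the following expansions hold, with absolutely convergent sums over all integers $1\le k_1<\dots<k_n$: $$P_n^{(0)}=C_0^n\,\Theta\sum_{1\le k_1<\dots<k_n}\ \prod_{j=1}^n\frac{1-p^{4k_j/3}}{1+p^{2k_j}}\,p^{(k_j-1)/3}\ \chi_{k_n,\dots,k_1,-k_1,\dots,-k_n}(x_1^2,\dots,x_{2n}^2),$$ $$P_n^{(2)}=C_2^n\,X\,\Theta'\sum_{1\le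 k_1<\dots<k_n}\ \prod_{j=1}^n\left(\frac{k_j+1}3\right)\frac{p^{k_j-1}}{1+p^{2k_j-1}}\ \chi_{k_n-1,\dots,k_1-1,-k_1,\dots,-k_n}(x_1^2,\dots,x_{2n}^2),$$ $$P_n^{(3)}=C_3^n\,X\,\Theta''\sum_{1\le k_1<\dots<k_n}\ \prod_{j=1}^n(-1)^{k_j}\frac{1-p^{(2k_j-1)/3}}{1-p^{2k_j-1}}\,p^{(2k_j-2)/3}\ \chi_{k_n-1,\dots,k_1-1,-k_1,\dots,-k_n}(x_1^2,\dots,x_{2n}^2),$$ $$P_n^{(4)}=C_4^n\,\Theta'\sum_{1\le k_1<\dots<k_n}\ \prod_{j=1}^n\left(\frac{k_j}3\right)\frac{p^{k_j-1}}{1+p^{2k_j}}\ \chi_{k_n,\dots,k_1,-k_1,\dots,-k_n}(x_1^2,\dots,x_{2n}^2),$$ $$P_n^{(6)}=C_6^n\,X\,\Theta\sum_{1\le k_1<\dots<k_n}\ \prod_{j=1}^n\frac{1-p^{(4k_j-2)/3}}{1+p^{2k_j-1}}\,p^{(k_j-1)/3}\ \chi_{k_n-1,\dots,k_1-1,-k_1,\dots,-k_n}(x_1^2,\dots,x_{2n}^2).$$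 -/

import Mathlib

open scoped BigOperators

namespace EllipticPfaffian

noncomputable section

/-- The infinite product `(a; q)_∞ = ∏_{j ≥ 0} (1 - a q^j)` (used for `‖q‖ < 1`). -/
def qProd (a q : ℂ) : ℂ := ∏' j : ℕ, (1 - a * q ^ j)

/-- The theta function `θ(x; q) = (x; q)_∞ (q/x; q)_∞`. -/
def theta (x q : ℂ) : ℂ := qProd x q * qProd (q / x) q

/-- The powers `p^l = exp(iπτl)` of the nome `p = exp(iπτ)`. -/
def pPow (τ : UpperHalfPlane) (l : ℂ) : ℂ :=
  Complex.exp (Complex.I * Real.pi * (τ : ℂ) * l)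

/-- The variables `x_j = exp(iπ z_j)`. -/
def xVar {m : ℕ} (z : Fin m → ℂ) (j : Fin m) : ℂ :=
  Complex.exp (Complex.I * Real.pi * z j)

/-- The Legendre symbol `(k/3)`. -/
def leg3 (k : ℤ) : ℂ := ((legendreSym 3 k : ℤ) : ℂ)

/-- The pfaffian
`1/(2^n n!) ∑_{σ ∈ S_{2n}} sgn(σ) ∏_{j=1}^n a_{σ(2j-1) σ(2j)}`
(with zero-based indices). -/
def pfaffian {n : ℕ} (a : Fin (2 * n) → Fin (2 * n) → ℂ) : ℂ :=
  1 / (2 ^ n * (n.factorial : ℂ)) *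
    ∑ σ : Equiv.Perm (Fin (2 * n)), ((Equiv.Perm.sign σ : ℤ) : ℂ) *
      ∏ j : Fin n, a (σ ⟨2 * (j : ℕ), by omega⟩) (σ ⟨2 * (j : ℕ) + 1, by omega⟩)

/-- The product `∏_{i < j} f i j`. -/
def prodLT {m : ℕ} (f : Fin m → Fin m → ℂ) : ℂ :=
  ∏ i : Fin m, ∏ j ∈ Finset.Ioi i, f i j

/-- The alternant `χ_μ(x) = det (x_i^{μ_j})`. -/
def alternant {m : ℕ} (μ : Fin m → ℤ) (x : Fin m → ℂ) : ℂ :=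
  Matrix.det (Matrix.of fun i j : Fin m => x i ^ μ j)

/-- The exponent vector `(k_n - s, …, k_1 - s, -k_1, …, -k_n)`. -/
def expVec {n : ℕ} (s : ℤ) (k : Fin n → ℤ) : Fin (2 * n) → ℤ :=
  Fin.append (fun j => k j.rev - s) (fun j => -k j) ∘ Fin.cast (two_mul n)

/-- The index set of all integer vectors with `1 ≤ k_1 < k_2 < ⋯ < k_n`. -/
abbrev IncTuple (n : ℕ) : Type :=
  {k : Fin n → ℤ // (∀ j, 1 ≤ k j) ∧ StrictMono k}

/-- The product prefactor in `P_n^{(0)}` and `P_n^{(6)}`. -/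
def pref06 {n : ℕ} (z : Fin (2 * n) → ℂ) (τ : UpperHalfPlane) : ℂ :=
  prodLT fun i j => theta (pPow τ (1 / 3) * xVar z i ^ 2 / xVar z j ^ 2) (pPow τ (2 / 3))

/-- The product prefactor in `P_n^{(2)}` and `P_n^{(4)}`. -/
def pref24 {n : ℕ} (z : Fin (2 * n) → ℂ) (τ : UpperHalfPlane) : ℂ :=
  prodLT fun i j => theta (pPow τ 3 * xVar z i ^ 6 / xVar z j ^ 6) (pPow τ 6)

/-- The product prefactor in `P_n^{(3)}`. -/
def pref3 {n : ℕ} (z : Fin (2 * n) → ℂ) (τ : UpperHalfPlane) : ℂ :=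
  prodLT fun i j =>
    xVar z j / xVar z i * theta (-(xVar z i ^ 2 / xVar z j ^ 2)) (pPow τ (2 / 3))

/-- `θ(y, -y, p y; p²)` with `y = x_i² / x_j²`. -/
def num034 {n : ℕ} (z : Fin (2 * n) → ℂ) (τ : UpperHalfPlane) (i j : Fin (2 * n)) : ℂ :=
  theta (xVar z i ^ 2 / xVar z j ^ 2) (pPow τ 2) *
    theta (-(xVar z i ^ 2 / xVar z j ^ 2)) (pPow τ 2) *
    theta (pPow τ 1 * xVar z i ^ 2 / xVar z j ^ 2) (pPow τ 2)

/-- `θ(y, p y, -p y; p²)` with `y = x_i² / x_j²`. -/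
def num26 {n : ℕ} (z : Fin (2 * n) → ℂ) (τ : UpperHalfPlane) (i j : Fin (2 * n)) : ℂ :=
  theta (xVar z i ^ 2 / xVar z j ^ 2) (pPow τ 2) *
    theta (pPow τ 1 * xVar z i ^ 2 / xVar z j ^ 2) (pPow τ 2) *
    theta (-(pPow τ 1 * xVar z i ^ 2 / xVar z j ^ 2)) (pPow τ 2)

/-- `P_n^{(0)}(z_1, …, z_{2n}; τ)`. -/
def P0 {n : ℕ} (z : Fin (2 * n) → ℂ) (τ : UpperHalfPlane) : ℂ :=
  pref06 z τ * pfaffian fun i j =>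
    xVar z j ^ 2 * num034 z τ i j /
      (xVar z i ^ 2 * theta (pPow τ (1 / 3) * xVar z i ^ 2 / xVar z j ^ 2) (pPow τ (2 / 3)))

/-- `P_n^{(2)}(z_1, …, z_{2n}; τ)`. -/
def P2 {n : ℕ} (z : Fin (2 * n) → ℂ) (τ : UpperHalfPlane) : ℂ :=
  pref24 z τ * pfaffian fun i j =>
    xVar z j * num26 z τ i j /
      (xVar z i * theta (pPow τ 3 * xVar z i ^ 6 / xVar z j ^ 6) (pPow τ 6))

/-- `P_n^{(3)}(z_1, …, z_{2n}; τ)`. On the real locus of the `z_j` the denominators vanish only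
where `x_i² = -x_j²`; these singularities of the matrix elements are removable, and the prefactor
vanishes there, so that the value `0` given by this formula is the value of the continuation. -/
def P3 {n : ℕ} (z : Fin (2 * n) → ℂ) (τ : UpperHalfPlane) : ℂ :=
  pref3 z τ * pfaffian fun i j =>
    xVar z j * num034 z τ i j /
      (xVar z i * theta (-(xVar z i ^ 2 / xVar z j ^ 2)) (pPow τ (2 / 3)))

/-- `P_n^{(4)}(z_1, …, z_{2n}; τ)`. -/
def P4 {n : ℕ} (z : Fin (2 * n) → ℂ) (τ : UpperHalfPlane) : ℂ :=
  pref24 z τ * pfaffian fun i j =>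
    xVar z j ^ 2 * num034 z τ i j /
      (xVar z i ^ 2 * theta (pPow τ 3 * xVar z i ^ 6 / xVar z j ^ 6) (pPow τ 6))

/-- `P_n^{(6)}(z_1, …, z_{2n}; τ)`. -/
def P6 {n : ℕ} (z : Fin (2 * n) → ℂ) (τ : UpperHalfPlane) : ℂ :=
  pref06 z τ * pfaffian fun i j =>
    xVar z j * num26 z τ i j /
      (xVar z i * theta (pPow τ (1 / 3) * xVar z i ^ 2 / xVar z j ^ 2) (pPow τ (2 / 3)))

/-- The constant `C_0`. -/
def C0 (τ : UpperHalfPlane) : ℂ :=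
  -(qProd (pPow τ 4) (pPow τ 4) /
    (qProd (pPow τ 2) (pPow τ 2) ^ 2 * qProd (pPow τ (4 / 3)) (pPow τ (4 / 3))))

/-- The constant `C_2`. -/
def C2 (τ : UpperHalfPlane) : ℂ :=
  qProd (-pPow τ 1) (-pPow τ 1) /
    (qProd (pPow τ 2) (pPow τ 2) ^ 2 * qProd (-pPow τ 3) (-pPow τ 3))

/-- The constant `C_3`. -/
def C3 (τ : UpperHalfPlane) : ℂ :=
  qProd (pPow τ 1) (pPow τ 1) /
    (qProd (pPow τ 2) (pPow τ 2) ^ 2 * qProd (pPow τ (1 / 3)) (pPow τ (1 / 3)))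

/-- The constant `C_4`. -/
def C4 (τ : UpperHalfPlane) : ℂ :=
  -(qProd (pPow τ 4) (pPow τ 4) /
    (qProd (pPow τ 2) (pPow τ 2) ^ 2 * qProd (pPow τ 12) (pPow τ 12)))

/-- The constant `C_6`. -/
def C6 (τ : UpperHalfPlane) : ℂ :=
  -(qProd (-pPow τ 1) (-pPow τ 1) /
    (qProd (pPow τ 2) (pPow τ 2) ^ 2 * qProd (-pPow τ (1 / 3)) (-pPow τ (1 / 3))))

/-- The Lambert-type coefficient for `σ = 0`. -/
def coeff0 (τ : UpperHalfPlane) (k : ℤ) : ℂ :=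
  (1 - pPow τ (4 * k / 3)) / (1 + pPow τ (2 * k)) * pPow τ ((k - 1) / 3)

/-- The Lambert-type coefficient for `σ = 2`. -/
def coeff2 (τ : UpperHalfPlane) (k : ℤ) : ℂ :=
  leg3 (k + 1) * (pPow τ (k - 1) / (1 + pPow τ (2 * k - 1)))

/-- The Lambert-type coefficient for `σ = 3`. -/
def coeff3 (τ : UpperHalfPlane) (k : ℤ) : ℂ :=
  (-1) ^ k * ((1 - pPow τ ((2 * k - 1) / 3)) / (1 - pPow τ (2 * k - 1))) *
    pPow τ ((2 * k - 2) / 3)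

/-- The Lambert-type coefficient for `σ = 4`. -/
def coeff4 (τ : UpperHalfPlane) (k : ℤ) : ℂ :=
  leg3 k * (pPow τ (k - 1) / (1 + pPow τ (2 * k)))

/-- The Lambert-type coefficient for `σ = 6`. -/
def coeff6 (τ : UpperHalfPlane) (k : ℤ) : ℂ :=
  (1 - pPow τ ((4 * k - 2) / 3)) / (1 + pPow τ (2 * k - 1)) * pPow τ ((k - 1) / 3)

/-- The term
`∏_j c(k_j) · χ_{k_n-s,…,k_1-s,-k_1,…,-k_n}(x_1², …, x_{2n}²)` of an expansion. -/
def term {n : ℕ} (c : ℤ → ℂ) (s : ℤ) (z : Fin (2 * n) → ℂ) (k : IncTuple n) : ℂ :=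
  (∏ j : Fin n, c (k.1 j)) * alternant (expVec s k.1) (fun i => xVar z i ^ 2)

end

end EllipticPfaffian

open EllipticPfaffian

/-! Write `r = p^{1/3}`, `q = p² = r⁶`, `t = x_i²/x_j²`. All five expansions are instances of one
identity.

Splitting the denominator theta function into three theta functions of nome `q`, one of which
cancels against the numerator, turns every matrix entry, up to a monomial, into `θ(t) θ(bqt) /
(θ(at) θ(qt/a))` with nome `q`. Here `a` is `r` (σ = 0, 6), `-r²` (σ = 3) or `r³ω` with `ω` a
primitive cube root of unity (σ = 2, 4), and `b² q^s = 1` with `s` equal to 0 or 1.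

Such a quotient is a constant times the bilateral Lambert series `∑ λ_k t^k`, `λ_k = (a^k - c
(q/a)^k)/(1 - b q^k)` (`LambertData.lambert_eq_theta`). To see this, multiply the series by `θ(at)
θ(qt/a)`. The Laurent coefficients of the product obey the same two-step recurrence as those of
`θ(t) θ(bqt)`; the solutions form a plane, and those summing to zero, that is, vanishing at `t = 1`,
form a line in it. Both functions lie on that line, and the constant is read off from the pole at `t
= 1/a`.

Since `λ_{s-k} = -λ_k`, the series folds onto `k ≥ 1` as `∑ λ_k (t^k - t^{s-k})`. The matrix is then
a sum of elementary alternating matrices `u_k(i) v_k(j) - v_k(i) u_k(j)`. Expanding the pfaffian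
multilinearly gives determinants with columns `u_{k_j}, v_{k_j}`. These are symmetric in the tuple
`k` and vanish when two indices coincide, so the sum reduces to increasing tuples
(`pfaffian_hasSum`), and the determinants are the alternants `χ`.

What remains in each case is to match coefficients (`coeff0_eq`, ...), constants (`const_zero`, ...,
resting on infinite product identities) and matrix entries (`entry_ratio_cubic_base`,
`entry_ratio_cube`, `entry_ratio_neg`). -/

namespace EllipticPfaffian

open Filter Topology

/-! ### Infinite products -/

theorem qProd_multipliable (a : ℂ) {q : ℂ} (hq : ‖q‖ < 1) :
    Multipliable fun j : ℕ => 1 - a * q ^ j := by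
  simp_rw [sub_eq_add_neg]
  apply multipliable_one_add_of_summable
  simp_rw [norm_neg, norm_mul, norm_pow]
  exact (summable_geometric_of_lt_one (norm_nonneg _) hq).mul_left _

theorem qProd_tendsto (a : ℂ) {q : ℂ} (hq : ‖q‖ < 1) :
    Tendsto (fun N => ∏ j ∈ Finset.range N, (1 - a * q ^ j)) atTop (𝓝 (qProd a q)) :=
  (qProd_multipliable a hq).hasProd.tendsto_prod_nat

theorem qProd_succ (a : ℂ) {q : ℂ} (hq : ‖q‖ < 1) :
    qProd a q = (1 - a) * qProd (a * q) q := by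
  have h1 := (tendsto_add_atTop_iff_nat 1).2 (qProd_tendsto a hq)
  refine tendsto_nhds_unique h1 ?_
  simp_rw [Finset.prod_range_succ']
  convert (qProd_tendsto (a * q) hq).const_mul (1 - a) using 2 with N
  rw [mul_comm]
  simp [pow_succ', mul_assoc]

theorem qProd_ne_zero {a q : ℂ} (hq : ‖q‖ < 1) (h : ∀ j : ℕ, a * q ^ j ≠ 1) : qProd a q ≠ 0 := by
  unfold qProd
  simp_rw [sub_eq_add_neg]
  apply tprod_one_add_ne_zero_of_summable
  · intro i hi
    exact h i (by linear_combination -hi)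
  · simp_rw [norm_neg, norm_mul, norm_pow]
    exact (summable_geometric_of_lt_one (norm_nonneg _) hq).mul_left _

theorem qProd_ne_zero_of_norm_lt {a q : ℂ} (hq : ‖q‖ < 1) (ha : ‖a‖ < 1) : qProd a q ≠ 0 := by
  refine qProd_ne_zero hq fun j hj => ?_
  have h : ‖a * q ^ j‖ < 1 := by
    rw [norm_mul, norm_pow]
    exact mul_lt_one_of_nonneg_of_lt_one_left (norm_nonneg _) ha (pow_le_one₀ (norm_nonneg _) hq.le)
  rw [hj, norm_one] at h
  exact lt_irrefl _ h

theorem qProd_one {q : ℂ} (hq : ‖q‖ < 1) : qProd 1 q = 0 := by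
  rw [qProd_succ 1 hq]; simp

theorem qProd_split (m : ℕ) (hm : m ≠ 0) (a : ℂ) {q : ℂ} (hq : ‖q‖ < 1) :
    qProd a q = ∏ i ∈ Finset.range m, qProd (a * q ^ i) (q ^ m) := by
  have hqm : ‖q ^ m‖ < 1 := by
    rw [norm_pow]; exact pow_lt_one₀ (norm_nonneg _) hq hm
  have h1 : Tendsto (fun N : ℕ => m * N) atTop atTop :=
    tendsto_id.const_mul_atTop' (Nat.pos_of_ne_zero hm)
  refine tendsto_nhds_unique ((qProd_tendsto a hq).comp h1) ?_
  refine (tendsto_finsetProd (Finset.range m)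
    fun i _ => qProd_tendsto (a * q ^ i) hqm).congr fun N => ?_
  rw [Function.comp_apply, Finset.prod_comm]
  induction N with
  | zero => simp
  | succ N ih =>
    rw [Finset.prod_range_succ, ih, Nat.mul_succ, Finset.prod_range_add]
    congr 1
    refine Finset.prod_congr rfl fun i _ => ?_
    ring

theorem qProd_two (a : ℂ) {q : ℂ} (hq : ‖q‖ < 1) :
    qProd a q = qProd a (q ^ 2) * qProd (a * q) (q ^ 2) := by
  rw [qProd_split 2 two_ne_zero a hq]
  simp [Finset.prod_range_succ]

theorem qProd_three (a : ℂ) {q : ℂ} (hq : ‖q‖ < 1) :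
    qProd a q = qProd a (q ^ 3) * qProd (a * q) (q ^ 3) * qProd (a * q ^ 2) (q ^ 3) := by
  rw [qProd_split 3 three_ne_zero a hq]
  simp [Finset.prod_range_succ]

theorem qProd_mul_neg (a : ℂ) {q : ℂ} (hq : ‖q‖ < 1) :
    qProd a q * qProd (-a) q = qProd (a ^ 2) (q ^ 2) := by
  have hq2 : ‖q ^ 2‖ < 1 := by
    rw [norm_pow]; exact pow_lt_one₀ (norm_nonneg _) hq two_ne_zero
  unfold qProd
  rw [← (qProd_multipliable a hq).tprod_mul (qProd_multipliable (-a) hq)]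
  refine tprod_congr fun j => ?_
  ring

theorem qProd_mul_cube {ω : ℂ} (hω : ω ^ 2 + ω + 1 = 0) (a : ℂ) {q : ℂ} (hq : ‖q‖ < 1) :
    qProd a q * qProd (ω * a) q * qProd (ω ^ 2 * a) q = qProd (a ^ 3) (q ^ 3) := by
  unfold qProd
  rw [← (qProd_multipliable a hq).tprod_mul (qProd_multipliable (ω * a) hq),
    ← ((qProd_multipliable a hq).mul (qProd_multipliable (ω * a) hq)).tprod_mul
      (qProd_multipliable (ω ^ 2 * a) hq)]
  refine tprod_congr fun j => ?_
  have h3 : ω ^ 3 = 1 := by linear_combination (ω - 1) * hω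
  linear_combination (-a * q ^ j + ω * (a * q ^ j) ^ 2) * hω - (a * q ^ j) ^ 3 * h3

/-! ### Euler's power series for `(x; q)_∞` -/

/-- Coefficients of Euler's expansion of `(x; q)_∞` in powers of `x`. -/
noncomputable def eulerCoeff (q : ℂ) : ℕ → ℂ
  | 0 => 1
  | n + 1 => -(q ^ n / (1 - q ^ (n + 1))) * eulerCoeff q n

theorem one_sub_pow_ne_zero {q : ℂ} (hq : ‖q‖ < 1) (n : ℕ) : 1 - q ^ (n + 1) ≠ 0 := by
  intro h
  have h1 : ‖q ^ (n + 1)‖ < 1 := by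
    rw [norm_pow]; exact pow_lt_one₀ (norm_nonneg _) hq n.succ_ne_zero
  rw [← sub_eq_zero.1 h, norm_one] at h1
  exact lt_irrefl _ h1

theorem eulerCoeff_succ {q : ℂ} (hq : ‖q‖ < 1) (n : ℕ) :
    eulerCoeff q (n + 1) * (1 - q ^ (n + 1)) = -q ^ n * eulerCoeff q n := by
  rw [eulerCoeff]
  field_simp [one_sub_pow_ne_zero hq n]

theorem eulerCoeff_ne_zero {q : ℂ} (hq0 : q ≠ 0) (hq : ‖q‖ < 1) (n : ℕ) : eulerCoeff q n ≠ 0 := by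
  induction n with
  | zero => simp [eulerCoeff]
  | succ n ih =>
    rw [eulerCoeff]
    exact mul_ne_zero (neg_ne_zero.2 (div_ne_zero (pow_ne_zero _ hq0) (one_sub_pow_ne_zero hq n))) ih

theorem tendsto_pow_zero {q : ℂ} (hq : ‖q‖ < 1) : Tendsto (fun n : ℕ => q ^ n) atTop (𝓝 0) :=
  tendsto_pow_atTop_nhds_zero_of_norm_lt_one hq

theorem eulerCoeff_summable {q : ℂ} (hq0 : q ≠ 0) (hq : ‖q‖ < 1) (x : ℂ) :
    Summable fun n => ‖eulerCoeff q n * x ^ n‖ := by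
  rcases eq_or_ne x 0 with rfl | hx
  · refine summable_of_ne_finset_zero (s := {0}) fun n hn => ?_
    rw [Finset.mem_singleton] at hn
    simp [hn]
  refine summable_of_ratio_test_tendsto_lt_one (l := 0) one_pos
    (.of_forall fun n => norm_ne_zero_iff.2
      (mul_ne_zero (eulerCoeff_ne_zero hq0 hq n) (pow_ne_zero _ hx))) ?_
  have h : Tendsto (fun n => -(q ^ n / (1 - q ^ (n + 1))) * x) atTop (𝓝 (-(0 / (1 - 0)) * x)) :=
    (((tendsto_pow_zero hq).div (((tendsto_add_atTop_iff_nat 1).2 (tendsto_pow_zero hq)).const_sub 1)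
      (by simp)).neg).mul_const x
  have h2 := h.norm
  simp only [sub_zero, zero_div, neg_zero, zero_mul, norm_zero] at h2
  refine h2.congr fun n => ?_
  rw [norm_norm, norm_norm, ← norm_div]
  congr 1
  have := eulerCoeff_ne_zero hq0 hq n
  rw [eulerCoeff]
  field_simp
  ring

theorem eulerSum_continuous {q : ℂ} (hq0 : q ≠ 0) (hq : ‖q‖ < 1) :
    Continuous fun x => ∑' n, eulerCoeff q n * x ^ n := by
  rw [continuous_iff_continuousAt]
  intro x
  have hR : 0 ≤ ‖x‖ + 1 := by positivity
  have h : ContinuousOn (fun x => ∑' n, eulerCoeff q n * x ^ n) (Metric.ball 0 (‖x‖ + 1)) := by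
    refine continuousOn_tsum (fun n => by fun_prop)
      (eulerCoeff_summable hq0 hq ((‖x‖ + 1 : ℝ) : ℂ)) fun n y hy => ?_
    rw [norm_mul, norm_mul, norm_pow, norm_pow, Complex.norm_real, Real.norm_of_nonneg hR]
    gcongr
    simpa using (mem_ball_zero_iff.1 hy).le
  exact h.continuousAt (Metric.isOpen_ball.mem_nhds (by simp))

theorem eulerSum_step {q : ℂ} (hq0 : q ≠ 0) (hq : ‖q‖ < 1) (x : ℂ) :
    ∑' n, eulerCoeff q n * x ^ n = (1 - x) * ∑' n, eulerCoeff q n * (x * q) ^ n := by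
  have s1 := (eulerCoeff_summable hq0 hq x).of_norm
  have s2 := (eulerCoeff_summable hq0 hq (x * q)).of_norm
  have h : ∑' n, (eulerCoeff q n * x ^ n - eulerCoeff q n * (x * q) ^ n)
      = -x * ∑' n, eulerCoeff q n * (x * q) ^ n := by
    rw [(s1.sub s2).tsum_eq_zero_add, ← tsum_mul_left]
    simp only [pow_zero, sub_self, zero_add]
    refine tsum_congr fun n => ?_
    have := eulerCoeff_succ hq n
    rw [mul_pow, mul_pow, pow_succ x]
    linear_combination x ^ n * x * this
  rw [s1.tsum_sub s2] at h
  linear_combination h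

theorem qProd_eq_tsum {q : ℂ} (hq0 : q ≠ 0) (hq : ‖q‖ < 1) (x : ℂ) :
    qProd x q = ∑' n, eulerCoeff q n * x ^ n := by
  -- The power series satisfies `f(x) = (1 - x) f(qx)`, as the product does. Iterating pushes the
  -- argument to 0, where `f` is continuous with value 1.
  have key : ∀ N : ℕ, ∑' n, eulerCoeff q n * x ^ n =
      (∏ j ∈ Finset.range N, (1 - x * q ^ j)) * ∑' n, eulerCoeff q n * (x * q ^ N) ^ n := by
    intro N
    induction N with
    | zero => simp
    | succ N ih =>
      rw [ih, eulerSum_step hq0 hq (x * q ^ N), Finset.prod_range_succ, pow_succ]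
      ring_nf
  have hc := (eulerSum_continuous hq0 hq).tendsto 0
  have h0 : ∑' n, eulerCoeff q n * (0 : ℂ) ^ n = 1 := by
    rw [tsum_eq_single 0 (fun n hn => by simp [hn])]
    simp [eulerCoeff]
  rw [h0] at hc
  have h1 : Tendsto (fun N : ℕ => x * q ^ N) atTop (𝓝 0) := by
    simpa using (tendsto_pow_zero hq).const_mul x
  have h2 := (qProd_tendsto x hq).mul (hc.comp h1)
  rw [mul_one] at h2
  refine tendsto_nhds_unique h2 (tendsto_const_nhds.congr fun N => key N)

theorem qProd_continuous {q : ℂ} (hq0 : q ≠ 0) (hq : ‖q‖ < 1) : Continuous fun x => qProd x q := by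
  simp_rw [qProd_eq_tsum hq0 hq]
  exact eulerSum_continuous hq0 hq

/-! ### Theta functions -/

theorem theta_inv_mul {q : ℂ} (hq0 : q ≠ 0) (x : ℂ) : theta (q / x) q = theta x q := by
  unfold theta
  rw [div_div_cancel₀ hq0, mul_comm]

theorem theta_mul_self {q x : ℂ} (hq : ‖q‖ < 1) (hq0 : q ≠ 0) (hx : x ≠ 0) :
    theta (q * x) q = -x⁻¹ * theta x q := by
  unfold theta
  rw [qProd_succ x hq, div_mul_cancel_left₀ hq0, qProd_succ x⁻¹ hq, mul_comm x q,
    ← div_eq_inv_mul]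
  field_simp
  ring

theorem theta_inv {q x : ℂ} (hq : ‖q‖ < 1) (hq0 : q ≠ 0) (hx : x ≠ 0) :
    theta x⁻¹ q = -x⁻¹ * theta x q := by
  rw [← theta_mul_self hq hq0 hx, ← theta_inv_mul hq0 (q * x)]
  congr 1
  field_simp

theorem theta_one {q : ℂ} (hq : ‖q‖ < 1) : theta 1 q = 0 := by
  rw [theta, qProd_one hq, zero_mul]

theorem theta_self {q : ℂ} (hq : ‖q‖ < 1) (hq0 : q ≠ 0) : theta q q = 0 := by
  rw [theta, div_self hq0, qProd_one hq, mul_zero]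

theorem theta_ne_zero_of_norm {q x : ℂ} (hq : ‖q‖ < 1) (h1 : ‖x‖ < 1) (h2 : ‖q‖ < ‖x‖) :
    theta x q ≠ 0 := by
  refine mul_ne_zero (qProd_ne_zero_of_norm_lt hq h1) (qProd_ne_zero_of_norm_lt hq ?_)
  rwa [norm_div, div_lt_one ((norm_nonneg _).trans_lt h2)]

theorem theta_continuousAt {q x : ℂ} (hq : ‖q‖ < 1) (hq0 : q ≠ 0) (hx : x ≠ 0) :
    ContinuousAt (fun y => theta y q) x := by
  unfold theta
  have h1 : ContinuousAt (fun y => q / y) x := by fun_prop (disch := assumption)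
  exact (qProd_continuous hq0 hq).continuousAt.mul
    ((qProd_continuous hq0 hq).continuousAt.comp h1)

/-! ### Absolutely convergent Laurent series -/

/-- The Laurent series `∑ g m x ^ m` converges absolutely to `v`. -/
structure LaurentSum (g : ℤ → ℂ) (x v : ℂ) : Prop where
  summable : Summable fun m => ‖g m * x ^ m‖
  hasSum : HasSum (fun m => g m * x ^ m) v

/-- The coefficients of a product of two Laurent series. -/
noncomputable def laurentConv (g h : ℤ → ℂ) (N : ℤ) : ℂ := ∑' m, g m * h (N - m)

theorem LaurentSum.comp_mul {g : ℤ → ℂ} {A x v : ℂ} (h : LaurentSum g (A * x) v) :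
    LaurentSum (fun m => g m * A ^ m) x v := by
  constructor
  · simpa only [mul_zpow, mul_assoc] using h.summable
  · simpa only [mul_zpow, mul_assoc] using h.hasSum

theorem LaurentSum.reflect {g : ℤ → ℂ} {x v : ℂ} (h : LaurentSum g x⁻¹ v) :
    LaurentSum (fun m => g (-m)) x v := by
  have e : ∀ m, g (-m) * x ^ m = (fun m => g m * x⁻¹ ^ m) (Equiv.neg ℤ m) := fun m => by
    simp
  constructor
  · simp_rw [e]
    exact ((Equiv.neg ℤ).summable_iff (f := fun m => ‖g m * x⁻¹ ^ m‖)).2 h.summable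
  · simp_rw [e]
    exact ((Equiv.neg ℤ).hasSum_iff (f := fun m => g m * x⁻¹ ^ m)).2 h.hasSum

/-- The reindexing `(N, m) ↦ (m, N - m)`. -/
def convEquiv : ℤ × ℤ ≃ ℤ × ℤ where
  toFun p := (p.2, p.1 - p.2)
  invFun p := (p.1 + p.2, p.1)
  left_inv p := by ext <;> simp
  right_inv p := by ext <;> simp

section Conv

variable {g h : ℤ → ℂ} {x v w : ℂ}

theorem LaurentSum.summable_prod (hg : LaurentSum g x v) (hh : LaurentSum h x w) (hx : x ≠ 0) :
    Summable fun p : ℤ × ℤ => ‖g p.2 * h (p.1 - p.2) * x ^ p.1‖ := by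
  have h1 := convEquiv.summable_iff.2 (hg.summable.mul_norm hh.summable)
  refine h1.congr fun p => ?_
  have : x ^ p.1 = x ^ p.2 * x ^ (p.1 - p.2) := by rw [← zpow_add₀ hx]; congr 1; ring
  simp only [Function.comp_apply, convEquiv, Equiv.coe_fn_mk, this]
  congr 1
  ring

theorem LaurentSum.conv_summable (hg : LaurentSum g x v) (hh : LaurentSum h x w) (hx : x ≠ 0)
    (N : ℤ) : Summable fun m => g m * h (N - m) := by
  have h1 := (hg.summable_prod hh hx).of_norm.prod_factor N
  exact (summable_mul_right_iff (zpow_ne_zero N hx)).1 h1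

theorem LaurentSum.mul (hg : LaurentSum g x v) (hh : LaurentSum h x w) (hx : x ≠ 0) :
    LaurentSum (laurentConv g h) x (v * w) := by
  have hs := hg.summable_prod hh hx
  have e : ∀ N, laurentConv g h N * x ^ N = ∑' m, g m * h (N - m) * x ^ N := fun N => by
    rw [tsum_mul_right]; rfl
  constructor
  · refine Summable.of_nonneg_of_le (fun _ => norm_nonneg _) (fun N => ?_) hs.prod
    rw [e]
    exact norm_tsum_le_tsum_norm (hs.prod_factor N)
  · have h1 : HasSum (fun p : ℤ × ℤ => g p.2 * h (p.1 - p.2) * x ^ p.1) (v * w) := by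
      have h2 := convEquiv.hasSum_iff.2
        (hg.hasSum.mul hh.hasSum (hg.summable.mul_norm hh.summable).of_norm)
      refine h2.congr_fun fun p => ?_
      have : x ^ p.1 = x ^ p.2 * x ^ (p.1 - p.2) := by rw [← zpow_add₀ hx]; congr 1; ring
      simp only [Function.comp_apply, convEquiv, Equiv.coe_fn_mk, this]
      ring
    refine h1.prod_fiberwise fun N => ?_
    rw [e]
    exact (hs.of_norm.prod_factor N).hasSum

end Conv

/-! ### The Laurent series of the theta function -/

/-- Euler's coefficients extended by zero to the integers. -/
noncomputable def eulerInt (q : ℂ) (n : ℤ) : ℂ := if 0 ≤ n then eulerCoeff q n.toNat else 0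

theorem eulerInt_laurentSum {q : ℂ} (hq0 : q ≠ 0) (hq : ‖q‖ < 1) (x : ℂ) :
    LaurentSum (eulerInt q) x (qProd x q) := by
  have h0 : ∀ n ∉ Set.range ((↑) : ℕ → ℤ), eulerInt q n = 0 := fun n hn => by
    rw [eulerInt, if_neg]
    intro h
    exact hn ⟨n.toNat, Int.toNat_of_nonneg h⟩
  constructor
  · refine (Nat.cast_injective.summable_iff fun n hn => ?_).1 ?_
    · rw [h0 n hn]; simp
    · simpa [Function.comp_def, eulerInt] using eulerCoeff_summable hq0 hq x
  · refine (Nat.cast_injective.hasSum_iff fun n hn => ?_).1 ?_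
    · rw [h0 n hn]; simp
    · rw [qProd_eq_tsum hq0 hq]
      simpa [Function.comp_def, eulerInt] using (eulerCoeff_summable hq0 hq x).of_norm.hasSum

theorem eulerInt_step {q : ℂ} (hq : ‖q‖ < 1) (n : ℤ) :
    eulerInt q n * (1 - q ^ n) = -q ^ (n - 1) * eulerInt q (n - 1) := by
  rcases lt_trichotomy n 0 with h | h | h
  · rw [eulerInt, eulerInt, if_neg (by omega), if_neg (by omega)]; simp
  · subst h
    simp [eulerInt]
  · obtain ⟨k, rfl⟩ : ∃ k : ℕ, n = k + 1 := ⟨(n - 1).toNat, by omega⟩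
    rw [add_sub_cancel_right]
    have := eulerCoeff_succ hq k
    have e : ((k : ℤ) + 1).toNat = k + 1 := by omega
    rw [eulerInt, eulerInt, if_pos (by omega), if_pos (by omega), e, Int.toNat_natCast]
    exact_mod_cast this

/-- The Laurent coefficients of `θ(x; q)`. -/
noncomputable def thetaCoeff (q : ℂ) : ℤ → ℂ :=
  laurentConv (eulerInt q) fun m => eulerInt q (-m) * q ^ (-m)

theorem eulerInt_reflect_laurentSum {q : ℂ} (hq0 : q ≠ 0) (hq : ‖q‖ < 1) (x : ℂ) :
    LaurentSum (fun m => eulerInt q (-m) * q ^ (-m)) x (qProd (q / x) q) := by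
  have h := eulerInt_laurentSum hq0 hq (q / x)
  rw [div_eq_mul_inv] at h
  exact h.comp_mul.reflect (g := fun m => eulerInt q m * q ^ m)

theorem theta_laurentSum {q x : ℂ} (hq0 : q ≠ 0) (hq : ‖q‖ < 1) (hx : x ≠ 0) :
    LaurentSum (thetaCoeff q) x (theta x q) :=
  (eulerInt_laurentSum hq0 hq x).mul (eulerInt_reflect_laurentSum hq0 hq x) hx

/-- The recurrence is derived from Euler's coefficients, without appeal to uniqueness of Laurent
coefficients. With `A` the coefficients of `(x; q)_∞ (1/x; q)_∞`, the factorizations `(1 - 1/x)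
θ(x)` and `(1 - x) θ(qx)` of that product give `h2` and `h1`. Together they make `θ_{N+1} + q^N θ_N`
independent of `N`; being summable over the integers, this constant is zero. -/
theorem thetaCoeff_succ {q : ℂ} (hq0 : q ≠ 0) (hq : ‖q‖ < 1) (N : ℤ) :
    thetaCoeff q (N + 1) = -q ^ N * thetaCoeff q N := by
  set f := eulerInt q with hf
  set A : ℤ → ℂ := laurentConv f fun m => f (-m) with hA
  have sE : ∀ N, Summable fun m => f m * (f (-(N - m)) * q ^ (-(N - m))) :=
    LaurentSum.conv_summable (g := f) (h := fun m => f (-m) * q ^ (-m))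
      (eulerInt_laurentSum hq0 hq 1) (eulerInt_reflect_laurentSum hq0 hq 1) one_ne_zero
  have sA : ∀ N, Summable fun m => f m * f (-(N - m)) :=
    LaurentSum.conv_summable (g := f) (h := fun m => f (-m)) (eulerInt_laurentSum hq0 hq 1)
      (LaurentSum.reflect (g := f) (eulerInt_laurentSum hq0 hq 1⁻¹)) one_ne_zero
  have h2 : ∀ N, thetaCoeff q N = A N + thetaCoeff q (N + 1) := by
    intro N
    simp only [thetaCoeff, hA, laurentConv]
    rw [← (sA N).tsum_add (sE (N + 1))]
    refine tsum_congr fun m => ?_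
    have h := eulerInt_step hq (-(N - m))
    rw [show -(N - m) - 1 = -(N + 1 - m) by ring] at h
    linear_combination -(f m) * h
  have h1 : ∀ N, q ^ N * thetaCoeff q N = A N + q ^ (N - 1) * thetaCoeff q (N - 1) := by
    intro N
    simp only [thetaCoeff, hA, laurentConv]
    rw [← (Equiv.subRight (1 : ℤ)).tsum_eq (fun m => f m * (f (-(N - 1 - m)) * q ^ (-(N - 1 - m))))]
    have s' : Summable fun m => f (Equiv.subRight (1 : ℤ) m) *
        (f (-(N - 1 - Equiv.subRight (1 : ℤ) m)) * q ^ (-(N - 1 - Equiv.subRight (1 : ℤ) m))) :=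
      (Equiv.subRight (1 : ℤ)).summable_iff.2 (sE (N - 1))
    rw [← tsum_mul_left, ← tsum_mul_left, ← (sA N).tsum_add (s'.mul_left _)]
    refine tsum_congr fun m => ?_
    have h := eulerInt_step hq m
    have e1 : q ^ N * q ^ (-(N - m)) = q ^ m := by rw [← zpow_add₀ hq0]; congr 1; ring
    have e2 : q ^ (N - 1) * q ^ (-(N - m)) = q ^ (m - 1) := by
      rw [← zpow_add₀ hq0]; congr 1; ring
    rw [Equiv.subRight_apply, show N - 1 - (m - 1) = N - m by ring]
    linear_combination f m * f (-(N - m)) * e1 - f (m - 1) * f (-(N - m)) * e2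
      - f (-(N - m)) * h
  have hd : ∀ N, thetaCoeff q (N + 1) + q ^ N * thetaCoeff q N
      = thetaCoeff q 1 + q ^ (0 : ℤ) * thetaCoeff q 0 := by
    have step : ∀ N, thetaCoeff q (N + 1) + q ^ N * thetaCoeff q N
        = thetaCoeff q N + q ^ (N - 1) * thetaCoeff q (N - 1) := fun N => by
      linear_combination h1 N - h2 N
    intro N
    induction N using Int.induction_on with
    | zero => simp
    | succ i ih => rw [← ih, step (i + 1), add_sub_cancel_right]
    | pred i ih => rw [← ih, step (-i), sub_add_cancel]
  -- The two terms are summable by absolute convergence of the theta series at `x = 1` and at `x =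
  -- q`.
  have hsum : Summable fun N : ℤ => thetaCoeff q (N + 1) + q ^ N * thetaCoeff q N := by
    have s1 := (theta_laurentSum hq0 hq one_ne_zero).summable.of_norm
    have s2 := (theta_laurentSum hq0 hq hq0).summable.of_norm
    simp only [one_zpow, mul_one] at s1
    refine Summable.add ((Equiv.addRight (1 : ℤ)).summable_iff.2 s1) (s2.congr fun m => mul_comm _ _)
  simp_rw [hd] at hsum
  have h0 := (summable_const_iff _).1 hsum
  have := hd N
  rw [h0] at this
  linear_combination this

/-- The Laurent coefficients of `θ(A x; q) θ(B x; q)`. -/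
noncomputable def thetaPair (q A B : ℂ) : ℤ → ℂ :=
  laurentConv (fun m => thetaCoeff q m * A ^ m) fun m => thetaCoeff q m * B ^ m

theorem thetaPair_laurentSum {q A B x : ℂ} (hq0 : q ≠ 0) (hq : ‖q‖ < 1) (hA : A ≠ 0) (hB : B ≠ 0)
    (hx : x ≠ 0) : LaurentSum (thetaPair q A B) x (theta (A * x) q * theta (B * x) q) :=
  (theta_laurentSum hq0 hq (mul_ne_zero hA hx)).comp_mul.mul
    (theta_laurentSum hq0 hq (mul_ne_zero hB hx)).comp_mul hx

/-- Shifting both factors of the convolution by one turns a total shift of 2 into the factor `q^m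
q^{N-m} = q^N`, the same for every summand. -/
theorem thetaPair_step {q A B : ℂ} (hq0 : q ≠ 0) (hq : ‖q‖ < 1) (hA : A ≠ 0) (hB : B ≠ 0) (N : ℤ) :
    thetaPair q A B (N + 2) = A * B * q ^ N * thetaPair q A B N := by
  simp only [thetaPair, laurentConv]
  rw [← (Equiv.addRight (1 : ℤ)).tsum_eq, ← tsum_mul_left]
  refine tsum_congr fun m => ?_
  rw [Equiv.coe_addRight, show N + 2 - (m + 1) = (N - m) + 1 by ring, thetaCoeff_succ hq0 hq,
    thetaCoeff_succ hq0 hq, zpow_add_one₀ hA, zpow_add_one₀ hB]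
  have e : q ^ N = q ^ m * q ^ (N - m) := by rw [← zpow_add₀ hq0]; congr 1; ring
  rw [e]
  ring

/-! ### Uniqueness of solutions of the two-step recurrence -/

theorem eq_zero_of_two_step {β u : ℤ → ℂ} (hβ : ∀ N, β N ≠ 0) (hu : ∀ N, u (N + 2) = β N * u N)
    (h0 : u 0 = 0) (h1 : u 1 = 0) (N : ℤ) : u N = 0 := by
  suffices H : u N = 0 ∧ u (N + 1) = 0 from H.1
  induction N using Int.induction_on with
  | zero => exact ⟨h0, h1⟩
  | succ i ih =>
    refine ⟨ih.2, ?_⟩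
    rw [add_assoc, one_add_one_eq_two, hu, ih.1, mul_zero]
  | pred i ih =>
    rw [sub_add_cancel]
    refine ⟨?_, ih.1⟩
    have := hu (-i - 1)
    rw [show -(i : ℤ) - 1 + 2 = -i + 1 by ring, ih.2] at this
    exact (mul_eq_zero.1 this.symm).resolve_left (hβ _)

/-- The solution space has dimension two, and summation is a linear functional on the span of `u`,
`v`, `w` that is nonzero because of `w`. Its kernel contains `u` and `v`, so these are dependent:
`key` is the linear relation among three vectors of a plane, and summing it kills the determinant
`δ`. -/
theorem proportional_of_two_step {β u v w : ℤ → ℂ} {W : ℂ} (hβ : ∀ N, β N ≠ 0)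
    (hu : ∀ N, u (N + 2) = β N * u N) (hv : ∀ N, v (N + 2) = β N * v N)
    (hw : ∀ N, w (N + 2) = β N * w N) (su : HasSum u 0) (sv : HasSum v 0) (sw : HasSum w W)
    (hW : W ≠ 0) (hne : v ≠ 0) : ∃ C : ℂ, ∀ N, u N = C * v N := by
  set δ := v 0 * u 1 - u 0 * v 1 with hδ
  have key : ∀ N, δ * w N - (v 0 * w 1 - w 0 * v 1) * u N - (w 0 * u 1 - u 0 * w 1) * v N = 0 := by
    refine eq_zero_of_two_step hβ (fun N => ?_) (by rw [hδ]; ring) (by rw [hδ]; ring)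
    rw [hu, hv, hw]; ring
  have hs := ((sw.mul_left δ).sub (su.mul_left (v 0 * w 1 - w 0 * v 1))).sub
    (sv.mul_left (w 0 * u 1 - u 0 * w 1))
  simp_rw [key] at hs
  have h0 := hs.unique hasSum_zero
  have hδ0 : δ = 0 := by
    have : δ * W = 0 := by linear_combination h0
    exact (mul_eq_zero.1 this).resolve_right hW
  have hv01 : v 0 ≠ 0 ∨ v 1 ≠ 0 := by
    by_contra! h
    exact hne (funext (eq_zero_of_two_step hβ hv h.1 h.2))
  rcases hv01 with h | h
  · refine ⟨u 0 / v 0, fun N => ?_⟩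
    refine sub_eq_zero.1
      (eq_zero_of_two_step (u := fun N => u N - u 0 / v 0 * v N) hβ (fun N => ?_) ?_ ?_ N)
    · simp only [hu, hv]; ring
    · simp [h]
    · field_simp; linear_combination hδ0
  · refine ⟨u 1 / v 1, fun N => ?_⟩
    refine sub_eq_zero.1
      (eq_zero_of_two_step (u := fun N => u N - u 1 / v 1 * v N) hβ (fun N => ?_) ?_ ?_ N)
    · simp only [hu, hv]; ring
    · field_simp; linear_combination -hδ0
    · simp [h]

/-! ### A Lambert-type bilateral series -/

theorem kronecker_summable {q b x : ℂ} (hq0 : q ≠ 0) (hq : ‖q‖ < 1) (hb0 : b ≠ 0)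
    (hx1 : ‖x‖ < 1) (hx2 : ‖q‖ < ‖x‖) : Summable fun k : ℤ => ‖x ^ k * (1 - b * q ^ k)⁻¹‖ := by
  have hx0 : x ≠ 0 := norm_pos_iff.1 ((norm_nonneg _).trans_lt hx2)
  refine summable_int_iff_summable_nat_and_neg.2 ⟨?_, ?_⟩
  · have h1 : Tendsto (fun n : ℕ => (1 - b * q ^ n)⁻¹) atTop (𝓝 (1 - b * 0)⁻¹) :=
      (((tendsto_pow_zero hq).const_mul b).const_sub 1).inv₀ (by simp)
    obtain ⟨M, hM⟩ := h1.norm.bddAbove_range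
    refine Summable.of_nonneg_of_le (fun _ => norm_nonneg _) (fun n => ?_)
      ((summable_geometric_of_lt_one (norm_nonneg x) hx1).mul_right M)
    rw [norm_mul, zpow_natCast, zpow_natCast, norm_pow]
    gcongr
    exact hM ⟨n, rfl⟩
  · have h1 : Tendsto (fun n : ℕ => (q ^ n - b)⁻¹) atTop (𝓝 (0 - b)⁻¹) :=
      ((tendsto_pow_zero hq).sub_const b).inv₀ (by simpa using hb0)
    obtain ⟨M, hM⟩ := h1.norm.bddAbove_range
    have h2 : ‖q / x‖ < 1 := by
      rwa [norm_div, div_lt_one (norm_pos_iff.2 hx0)]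
    refine Summable.of_nonneg_of_le (fun _ => norm_nonneg _) (fun n => ?_)
      ((summable_geometric_of_lt_one (norm_nonneg (q / x)) h2).mul_right M)
    -- For negative index the denominator grows like `q^{-n}`, which turns the ratio `1/x` into
    -- `q/x`; hence the annulus `|q| < |x| < 1`.
    have e : x ^ (-(n : ℤ)) * (1 - b * q ^ (-(n : ℤ)))⁻¹ = (q / x) ^ n * (q ^ n - b)⁻¹ := by
      rw [zpow_neg, zpow_neg, zpow_natCast, zpow_natCast, div_pow, div_eq_inv_mul, mul_assoc]
      congr 1
      have hqn : q ^ n ≠ 0 := pow_ne_zero _ hq0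
      rw [show 1 - b * (q ^ n)⁻¹ = (q ^ n - b) * (q ^ n)⁻¹ by field_simp, mul_inv, inv_inv, mul_comm]
    rw [e, norm_mul, norm_pow]
    gcongr
    exact hM ⟨n, rfl⟩

/-- The coefficients `(a^k - c (q/a)^k) / (1 - b q^k)`. -/
noncomputable def lambert (q a b c : ℂ) (k : ℤ) : ℂ := (a ^ k - c * (q / a) ^ k) / (1 - b * q ^ k)

/-- Conditions on the parameters of a Lambert-type series under which it is a theta quotient. -/
structure LambertData (q a b c : ℂ) (s : ℤ) : Prop where
  q_ne_zero : q ≠ 0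
  norm_q : ‖q‖ < 1
  a_ne_zero : a ≠ 0
  norm_a : ‖a‖ < 1
  norm_q_div : ‖q / a‖ ≤ ‖a‖
  sq_ne : q / a ^ 2 ≠ 1
  b_ne_zero : b ≠ 0
  b_ne : ∀ k : ℤ, b * q ^ k ≠ 1
  b_sq : b ^ 2 * q ^ s = 1
  c_eq : c = -b * a ^ s
  theta_a : theta a q ≠ 0
  theta_b : theta (b * q / a) q ≠ 0

namespace LambertData

variable {q a b c : ℂ} {s : ℤ} (h : LambertData q a b c s)
include h

theorem denom_ne_zero (k : ℤ) : 1 - b * q ^ k ≠ 0 := fun hk => h.b_ne k (by linear_combination -hk)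

theorem lambert_summable {y : ℂ} (h1 : ‖a‖ < ‖y‖) (h2 : ‖a‖ * ‖y‖ < 1) :
    Summable fun k => ‖lambert q a b c k * y ^ k‖ := by
  have ha := norm_pos_iff.2 h.a_ne_zero
  have hqa : q / a ≠ 0 := div_ne_zero h.q_ne_zero h.a_ne_zero
  -- The two numerator terms are Lambert-type series at `ay` and `qy/a`. Since `|q/a| ≤ |a|`, the
  -- annulus `|a| < |y| < 1/|a|` suffices for both.
  have s1 := kronecker_summable h.q_ne_zero h.norm_q h.b_ne_zero (x := a * y)
    (by rwa [norm_mul]) (by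
      have := h.norm_q_div.trans_lt h1
      rwa [norm_div, div_lt_iff₀ ha, mul_comm, ← norm_mul] at this)
  have s2 := kronecker_summable h.q_ne_zero h.norm_q h.b_ne_zero (x := q / a * y)
    (by
      rw [norm_mul]
      exact (mul_le_mul_of_nonneg_right h.norm_q_div (norm_nonneg _)).trans_lt h2) (by
      rw [norm_mul, norm_div, div_mul_eq_mul_div, lt_div_iff₀ ha]
      exact mul_lt_mul_of_pos_left h1 (norm_pos_iff.2 h.q_ne_zero))
  refine (s1.of_norm.sub (s2.of_norm.mul_left c)).norm.congr fun k => ?_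
  rw [lambert, mul_zpow, mul_zpow]
  congr 1
  rw [div_eq_mul_inv]
  ring

theorem lambert_laurentSum {y : ℂ} (h1 : ‖a‖ < ‖y‖) (h2 : ‖a‖ * ‖y‖ < 1) :
    LaurentSum (lambert q a b c) y (∑' k, lambert q a b c k * y ^ k) :=
  ⟨h.lambert_summable h1 h2, (h.lambert_summable h1 h2).of_norm.hasSum⟩

/-- The conditions `b² q^s = 1` and `c = -b a^s` are designed for this antisymmetry. It makes the
series vanish at `y = 1`, and later allows the folding onto positive indices. -/
theorem lambert_reflect (k : ℤ) : lambert q a b c (s - k) = -lambert q a b c k := by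
  have ha := h.a_ne_zero
  have hq := h.q_ne_zero
  have hb := h.b_ne_zero
  have hd := h.denom_ne_zero k
  have hd' := h.denom_ne_zero (s - k)
  have hqs : q ^ s = (b ^ 2)⁻¹ := eq_inv_of_mul_eq_one_right h.b_sq
  have e1 : 1 - b * q ^ (s - k) = -(1 - b * q ^ k) * (b * q ^ k)⁻¹ := by
    rw [zpow_sub₀ hq, hqs]
    have := zpow_ne_zero k hq
    field_simp
    ring
  rw [lambert, lambert, h.c_eq, e1, zpow_sub₀ ha, div_zpow, div_zpow, zpow_sub₀ hq, zpow_sub₀ ha, hqs]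
  have hak := zpow_ne_zero k ha
  have has := zpow_ne_zero s ha
  have hqk := zpow_ne_zero k hq
  field_simp
  ring

theorem lambert_sum_one : HasSum (lambert q a b c) 0 := by
  have hs := (h.lambert_laurentSum (y := 1) (by simpa using h.norm_a)
    (by simpa using h.norm_a)).hasSum
  simp only [one_zpow, mul_one] at hs
  have h2 := (Equiv.subLeft s).hasSum_iff.2 hs
  have e : lambert q a b c ∘ Equiv.subLeft s = fun k => -lambert q a b c k :=
    funext fun k => h.lambert_reflect k
  rw [e] at h2
  have := h2.unique hs.neg
  rwa [self_eq_neg.1 this] at hs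

/-- In `D (m + 2) λ_{N-m} = q q^m D(m) λ_{N-m}`, clearing the denominator of `λ` gives `q^m λ_{N-m}
= b q^N λ_{N-m} + a^N (q/a)^m - c (q/a)^N a^m`. The last two terms sum to the values of `θ(ay)
θ(qy/a)` at `y = q/a` and `y = a`, which are zero because `θ(q; q) = 0`. -/
theorem conv_step (N : ℤ) :
    laurentConv (thetaPair q a (q / a)) (lambert q a b c) (N + 2)
      = b * q * q ^ N * laurentConv (thetaPair q a (q / a)) (lambert q a b c) N := by
  have ha := h.a_ne_zero
  have hq := h.q_ne_zero
  have hqa : q / a ≠ 0 := div_ne_zero hq ha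
  set D := thetaPair q a (q / a) with hD
  have hDsum : ∀ {x}, x ≠ 0 → LaurentSum D x (theta (a * x) q * theta (q / a * x) q) :=
    fun hx => thetaPair_laurentSum hq h.norm_q ha hqa hx
  have hstep : ∀ m, D (m + 2) = q * q ^ m * D m := fun m => by
    rw [hD, thetaPair_step hq h.norm_q ha hqa, mul_div_cancel₀ _ ha]
  have hs : ∀ N, HasSum (fun m => D m * lambert q a b c (N - m))
      (laurentConv D (lambert q a b c) N) := fun N =>
    ((hDsum one_ne_zero).conv_summable (h.lambert_laurentSum (y := 1) (by simpa using h.norm_a)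
    (by simpa using h.norm_a)) one_ne_zero N).hasSum
  have z1 : HasSum (fun m => D m * (q / a) ^ m) 0 := by
    have := (hDsum hqa).hasSum
    rwa [mul_div_cancel₀ _ ha, theta_self h.norm_q hq, zero_mul] at this
  have z2 : HasSum (fun m => D m * a ^ m) 0 := by
    have := (hDsum ha).hasSum
    rwa [div_mul_cancel₀ _ ha, theta_self h.norm_q hq, mul_zero] at this
  have t1 := (Equiv.addRight (2 : ℤ)).hasSum_iff.2 (hs (N + 2))
  have t2 := (((hs N).mul_left (b * q * q ^ N)).add (z1.mul_left (q * a ^ N))).sub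
    (z2.mul_left (q * c * (q / a) ^ N))
  rw [mul_zero, mul_zero, add_zero, sub_zero] at t2
  refine t1.unique (t2.congr_fun fun m => ?_)
  simp only [Function.comp_apply, Equiv.coe_addRight]
  rw [hstep, show N + 2 - (m + 2) = N - m by ring]
  have hl : lambert q a b c (N - m) * (1 - b * q ^ (N - m)) = a ^ (N - m) - c * (q / a) ^ (N - m) :=
    div_mul_cancel₀ _ (h.denom_ne_zero _)
  have e1 : q ^ N = q ^ m * q ^ (N - m) := by rw [← zpow_add₀ hq]; congr 1; ring
  have e2 : q ^ m * a ^ (N - m) = a ^ N * (q / a) ^ m := by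
    rw [zpow_sub₀ ha, div_zpow]; ring
  have e3 : q ^ m * (q / a) ^ (N - m) = (q / a) ^ N * a ^ m := by
    have := zpow_ne_zero m hq
    have := zpow_ne_zero m ha
    have := zpow_ne_zero N ha
    rw [zpow_sub₀ hqa, div_zpow, div_zpow]; field_simp
  rw [e1]
  linear_combination q * D m * q ^ m * hl + q * D m * e2 - q * D m * c * e3

theorem exists_const : ∃ C : ℂ, ∀ y : ℂ, ‖a‖ < ‖y‖ → ‖a‖ * ‖y‖ < 1 →
    (∑' k, lambert q a b c k * y ^ k) * (theta (a * y) q * theta (q / a * y) q)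
      = C * (theta y q * theta (b * q * y) q) := by
  have ha := h.a_ne_zero
  have hq := h.q_ne_zero
  have hqa : q / a ≠ 0 := div_ne_zero hq ha
  have hbq : b * q ≠ 0 := mul_ne_zero h.b_ne_zero hq
  have hbqa : b * q / a ≠ 0 := div_ne_zero hbq ha
  have hT : ∀ {y : ℂ}, ‖a‖ < ‖y‖ → ‖a‖ * ‖y‖ < 1 →
      LaurentSum (laurentConv (thetaPair q a (q / a)) (lambert q a b c)) y
        (theta (a * y) q * theta (q / a * y) q * ∑' k, lambert q a b c k * y ^ k) := fun h1 h2 => by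
    have hy := norm_pos_iff.1 ((norm_nonneg _).trans_lt h1)
    exact (thetaPair_laurentSum hq h.norm_q ha hqa hy).mul (h.lambert_laurentSum h1 h2) hy
  have hv : ∀ {y : ℂ}, y ≠ 0 → HasSum (fun k => thetaPair q 1 (b * q) k * y ^ k)
      (theta y q * theta (b * q * y) q) := fun hy => by
    have := (thetaPair_laurentSum hq h.norm_q one_ne_zero hbq hy).hasSum
    rwa [one_mul] at this
  have hw := (thetaPair_laurentSum hq h.norm_q ha hbqa one_ne_zero).hasSum
  simp only [one_zpow, mul_one] at hw
  obtain ⟨C, hC⟩ := proportional_of_two_step (β := fun N => b * q * q ^ N)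
    (u := laurentConv (thetaPair q a (q / a)) (lambert q a b c)) (v := thetaPair q 1 (b * q))
    -- The comparison solution `θ(ay) θ(bqy/a)` obeys the same recurrence and does not vanish at `y
    -- = 1`.
    (w := thetaPair q a (b * q / a))
    (fun N => mul_ne_zero hbq (zpow_ne_zero N hq)) h.conv_step
    (fun N => by rw [thetaPair_step hq h.norm_q one_ne_zero hbq, one_mul])
    (fun N => by rw [thetaPair_step hq h.norm_q ha hbqa, mul_div_cancel₀ _ ha])
    (by
      have h1 := (hT (y := 1) (by simpa using h.norm_a) (by simpa using h.norm_a)).hasSum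
      have h0 : ∑' k, lambert q a b c k = 0 := h.lambert_sum_one.tsum_eq
      simpa only [one_zpow, mul_one, h0, mul_zero] using h1)
    (by
      have h1 := hv one_ne_zero
      simpa only [one_zpow, mul_one, theta_one h.norm_q, zero_mul] using h1)
    hw (mul_ne_zero h.theta_a h.theta_b) (by
      intro h0
      -- The coefficients of `θ(y) θ(bqy)` are not all zero because the function is nonzero at `y =
      -- 1/a`.
      have h1 := hv (inv_ne_zero ha)
      simp only [h0, Pi.zero_apply, zero_mul] at h1
      have h2 := h1.unique hasSum_zero
      rw [theta_inv h.norm_q hq ha, ← div_eq_mul_inv] at h2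
      exact mul_ne_zero (mul_ne_zero (neg_ne_zero.2 (inv_ne_zero ha)) h.theta_a) h.theta_b h2)
  refine ⟨C, fun y h1 h2 => ?_⟩
  have hy := norm_pos_iff.1 ((norm_nonneg _).trans_lt h1)
  have t1 := (hT h1 h2).hasSum
  simp_rw [hC, mul_assoc C] at t1
  have := t1.unique ((hv hy).mul_left C)
  rw [← this, mul_comm]

omit h in
theorem norm_mul_ofReal_lt_one {μ : ℂ} (hμ : ‖μ‖ ≤ 1) {t : ℝ} (ht0 : 0 < t) (ht1 : t < 1) :
    ‖μ * t‖ < 1 := by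
  rw [norm_mul, Complex.norm_real, Real.norm_of_nonneg ht0.le]
  exact (mul_le_of_le_one_left ht0.le hμ).trans_lt ht1

theorem norm_sq_le : ‖q / a ^ 2‖ ≤ 1 := by
  have ha := norm_pos_iff.2 h.a_ne_zero
  rw [pow_two, ← div_div, norm_div, div_le_one ha]
  exact h.norm_q_div

/-- As `y = t/a` approaches the edge of the annulus, the nonnegative half of the series behaves like
`∑ (t^n - c (μt)^n)` with `μ = q/a²`. The second geometric series is removed as well because `|μ| =
1` can occur (`μ = ω` in the cubic cases), when it is not termwise dominated. What is left, `ρ n`,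
carries a factor `q^n`. -/
theorem exists_bound {t₀ : ℝ} (h0 : ‖a‖ ^ 2 < t₀) (h1 : t₀ < 1) :
    ∃ M : ℝ, ∀ t : ℝ, t₀ ≤ t → t < 1 →
      ‖(∑' k, lambert q a b c k * (t / a) ^ k) - (1 - (t : ℂ))⁻¹ + c * (1 - q / a ^ 2 * t)⁻¹‖ ≤ M := by
  have ha := h.a_ne_zero
  have hna := norm_pos_iff.2 ha
  have ht₀ : 0 < t₀ := (sq_nonneg _).trans_lt h0
  set μ := q / a ^ 2 with hμ
  have hμ1 : ‖μ‖ ≤ 1 := h.norm_sq_le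
  have hsum : ∀ t : ℝ, t₀ ≤ t → t < 1 →
      Summable fun k => ‖lambert q a b c k * ((t : ℂ) / a) ^ k‖ := fun t h3 h4 => by
    have e : ‖(t : ℂ) / a‖ = t / ‖a‖ := by
      rw [norm_div, Complex.norm_real, Real.norm_of_nonneg (ht₀.le.trans h3)]
    refine h.lambert_summable ?_ ?_
    · rw [e, lt_div_iff₀ hna, ← pow_two]; exact h0.trans_le h3
    · rwa [e, mul_div_cancel₀ _ hna.ne']
  have hneg : Summable fun n : ℕ => ‖lambert q a b c (-(n + 1)) * ((t₀ : ℂ) / a) ^ (-((n : ℤ) + 1))‖ :=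
    (hsum t₀ le_rfl h1).comp_injective (i := fun n : ℕ => -((n : ℤ) + 1))
      fun m n hmn => by simpa using hmn
  have hlim : Tendsto (fun n : ℕ => (1 - b * q ^ n)⁻¹) atTop (𝓝 (1 - b * 0)⁻¹) :=
    (((tendsto_pow_zero h.norm_q).const_mul b).const_sub 1).inv₀ (by simp)
  obtain ⟨M, hM⟩ := hlim.norm.bddAbove_range
  set ρ : ℕ → ℂ := fun n => b * q ^ n * ((1 - c * μ ^ n) * (1 - b * q ^ n)⁻¹) with hρ
  have hρs : Summable fun n => ‖ρ n‖ := by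
    refine Summable.of_nonneg_of_le (fun _ => norm_nonneg _) (fun n => ?_)
      ((summable_geometric_of_lt_one (norm_nonneg q) h.norm_q).mul_right (‖b‖ * ((1 + ‖c‖) * M)))
    have hn : ‖1 - c * μ ^ n‖ ≤ 1 + ‖c‖ := by
      refine (norm_sub_le _ _).trans ?_
      rw [norm_one, norm_mul, norm_pow]
      gcongr
      exact mul_le_of_le_one_right (norm_nonneg _) (pow_le_one₀ (norm_nonneg _) hμ1)
    rw [hρ]
    simp only [norm_mul, norm_pow]
    rw [mul_comm ‖b‖, mul_assoc]
    gcongr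
    exact hM ⟨n, rfl⟩
  refine ⟨∑' n, ‖ρ n‖ +
    ∑' n : ℕ, ‖lambert q a b c (-(n + 1)) * ((t₀ : ℂ) / a) ^ (-((n : ℤ) + 1))‖, fun t h3 h4 => ?_⟩
  have ht := ht₀.trans_le h3
  have hS := hsum t h3 h4
  have hSn : Summable fun n : ℕ => lambert q a b c n * ((t : ℂ) / a) ^ (n : ℤ) :=
    hS.of_norm.comp_injective Nat.cast_injective
  have hSneg : Summable fun n : ℕ =>
      ‖lambert q a b c (-(n + 1)) * ((t : ℂ) / a) ^ (-((n : ℤ) + 1))‖ :=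
    hS.comp_injective (i := fun n : ℕ => -((n : ℤ) + 1)) fun m n hmn => by simpa using hmn
  have hnt : ‖(t : ℂ)‖ = t := by rw [Complex.norm_real, Real.norm_of_nonneg ht.le]
  have g1 : HasSum (fun n : ℕ => (t : ℂ) ^ n) (1 - (t : ℂ))⁻¹ :=
    hasSum_geometric_of_norm_lt_one (by rwa [hnt])
  have g2 : HasSum (fun n : ℕ => (μ * t) ^ n) (1 - μ * t)⁻¹ :=
    hasSum_geometric_of_norm_lt_one (norm_mul_ofReal_lt_one hμ1 ht h4)
  have hpos : ∀ n : ℕ, lambert q a b c n * ((t : ℂ) / a) ^ (n : ℤ) - (t : ℂ) ^ n + c * (μ * t) ^ n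
      = ρ n * (t : ℂ) ^ n := fun n => by
    have hd := h.denom_ne_zero n
    rw [zpow_natCast] at hd
    have e1 : a ^ n * ((t : ℂ) / a) ^ n = (t : ℂ) ^ n := by rw [← mul_pow, mul_div_cancel₀ _ ha]
    have e2 : (q / a) ^ n * ((t : ℂ) / a) ^ n = μ ^ n * (t : ℂ) ^ n := by
      rw [← mul_pow, ← mul_pow, hμ]; congr 1; field_simp
    rw [lambert, hρ, mul_pow]
    simp only [zpow_natCast]
    rw [div_mul_eq_mul_div, sub_mul, e1, mul_assoc c, e2]
    field_simp
    ring
  have key : (∑' k, lambert q a b c k * ((t : ℂ) / a) ^ k) - (1 - (t : ℂ))⁻¹ + c * (1 - μ * t)⁻¹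
      = ∑' n, ρ n * (t : ℂ) ^ n +
        ∑' n : ℕ, lambert q a b c (-(n + 1)) * ((t : ℂ) / a) ^ (-((n : ℤ) + 1)) := by
    rw [tsum_of_nat_of_neg_add_one (f := fun k => lambert q a b c k * ((t : ℂ) / a) ^ k) hSn
      hSneg.of_norm, ← g1.tsum_eq, ← g2.tsum_eq, ← tsum_mul_left]
    rw [← tsum_congr hpos, (hSn.sub g1.summable).tsum_add (g2.summable.mul_left c), hSn.tsum_sub g1.summable]
    ring
  rw [key]
  -- The negative half decreases in `t`, termwise in norm, so its norms at `t₀` dominate.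
  refine (norm_add_le _ _).trans (add_le_add ?_ ?_)
  · refine tsum_of_norm_bounded hρs.hasSum fun n => ?_
    rw [norm_mul, norm_pow, hnt]
    exact mul_le_of_le_one_right (norm_nonneg _) (pow_le_one₀ ht.le h4.le)
  · refine tsum_of_norm_bounded hneg.hasSum fun n => ?_
    rw [norm_mul, norm_mul, norm_zpow, norm_zpow, norm_div, norm_div, hnt, Complex.norm_real,
      Real.norm_of_nonneg ht₀.le, zpow_neg, zpow_neg]
    gcongr
    have : (0 : ℤ) ≤ n + 1 := by positivity
    lift ((n : ℤ) + 1) to ℕ using this with k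
    simp only [zpow_natCast]
    gcongr

theorem lambert_tendsto :
    Tendsto (fun t : ℝ => (1 - (t : ℂ)) * ∑' k, lambert q a b c k * (t / a) ^ k) (𝓝[<] 1) (𝓝 1) := by
  have hsq : ‖a‖ ^ 2 < 1 := pow_lt_one₀ (norm_nonneg _) h.norm_a two_ne_zero
  obtain ⟨t₀, h0, h1⟩ := exists_between hsq
  obtain ⟨M, hM⟩ := h.exists_bound h0 h1
  have hev : ∀ᶠ t : ℝ in 𝓝[<] 1, t₀ ≤ t ∧ t < 1 := by
    filter_upwards [Ioo_mem_nhdsLT h1] with t ht using ⟨ht.1.le, ht.2⟩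
  have hc : Tendsto (fun t : ℝ => (t : ℂ)) (𝓝[<] 1) (𝓝 1) :=
    (Complex.continuous_ofReal.tendsto' 1 1 (by simp)).mono_left nhdsWithin_le_nhds
  have h2 : Tendsto (fun t : ℝ => (1 - (t : ℂ)) * ((∑' k, lambert q a b c k * (t / a) ^ k)
      - (1 - (t : ℂ))⁻¹ + c * (1 - q / a ^ 2 * t)⁻¹)) (𝓝[<] 1) (𝓝 0) := by
    have hb : Tendsto (fun t : ℝ => ‖1 - (t : ℂ)‖ * M) (𝓝[<] 1) (𝓝 0) := by
      have := ((hc.const_sub 1).norm).mul_const M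
      simpa using this
    refine squeeze_zero_norm' ?_ hb
    filter_upwards [hev] with t ht
    rw [norm_mul]
    gcongr
    exact hM t ht.1 ht.2
  -- The removed term `c/(1 - μt)` stays finite because `μ ≠ 1`, so the factor `1 - t` kills it.
  have h3 : Tendsto (fun t : ℝ => (1 - (t : ℂ)) * (c * (1 - q / a ^ 2 * t)⁻¹)) (𝓝[<] 1)
      (𝓝 ((1 - 1) * (c * (1 - q / a ^ 2 * 1)⁻¹))) :=
    (hc.const_sub 1).mul ((((hc.const_mul _).const_sub 1).inv₀
      (by rw [mul_one]; exact sub_ne_zero.2 h.sq_ne.symm)).const_mul c)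
  rw [sub_self, zero_mul] at h3
  have h4 := (h2.sub h3).add_const 1
  rw [sub_zero, zero_add] at h4
  refine h4.congr' ?_
  filter_upwards [hev] with t ht
  have : 1 - (t : ℂ) ≠ 0 := by
    rw [sub_ne_zero]
    exact_mod_cast ht.2.ne'
  field_simp
  ring

theorem lambert_eq_theta {y : ℂ} (h1 : ‖a‖ < ‖y‖) (h2 : ‖a‖ * ‖y‖ < 1) :
    (∑' k, lambert q a b c k * y ^ k) * (theta (a * y) q * theta (q / a * y) q)
        * (-a⁻¹ * theta a q * theta (b * q / a) q)
      = qProd q q ^ 2 * theta (q / a ^ 2) q * (theta y q * theta (b * q * y) q) := by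
  have ha := h.a_ne_zero
  have hna := norm_pos_iff.2 ha
  have hq := h.q_ne_zero
  obtain ⟨C, hC⟩ := h.exists_const
  suffices hCv : C * (-a⁻¹ * theta a q * theta (b * q / a) q) = qProd q q ^ 2 * theta (q / a ^ 2) q by
    rw [hC y h1 h2, ← hCv]; ring
  rw [← theta_inv h.norm_q hq ha, div_eq_mul_inv (b * q)]
  have hc : Tendsto (fun t : ℝ => (t : ℂ)) (𝓝[<] 1) (𝓝 1) :=
    (Complex.continuous_ofReal.tendsto' 1 1 (by simp)).mono_left nhdsWithin_le_nhds
  have hq2 : q / a ^ 2 ≠ 0 := div_ne_zero hq (pow_ne_zero 2 ha)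
  have hθ : ∀ {d : ℂ}, d ≠ 0 → Tendsto (fun t : ℝ => theta (d * t) q) (𝓝[<] 1) (𝓝 (theta d q)) :=
    fun {d} hd => by
      refine (theta_continuousAt h.norm_q hq hd).tendsto.comp ?_
      simpa using hc.const_mul d
  have l1 : Tendsto (fun t : ℝ => C * (theta (a⁻¹ * t) q * theta (b * q * a⁻¹ * t) q)) (𝓝[<] 1)
      (𝓝 (C * (theta a⁻¹ q * theta (b * q * a⁻¹) q))) :=
    ((hθ (inv_ne_zero ha)).mul (hθ (mul_ne_zero (mul_ne_zero h.b_ne_zero hq)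
      (inv_ne_zero ha)))).const_mul C
  -- At `y = t/a` the zero of `θ(ay) = θ(t) = (1 - t)(tq; q)_∞ (q/t; q)_∞` cancels the simple pole
  -- of the series, leaving `(q; q)_∞² θ(q/a²)` in the limit.
  have l2 : Tendsto (fun t : ℝ => (1 - (t : ℂ)) * (∑' k, lambert q a b c k * (t / a) ^ k) *
      (qProd (t * q) q * qProd (q / t) q * theta (q / a ^ 2 * t) q)) (𝓝[<] 1)
      (𝓝 (1 * (qProd (1 * q) q * qProd (q / 1) q * theta (q / a ^ 2) q))) := by
    have hp := qProd_continuous hq h.norm_q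
    refine h.lambert_tendsto.mul (Tendsto.mul (Tendsto.mul ?_ ?_) (hθ hq2))
    · exact (hp.tendsto _).comp (hc.mul_const q)
    · exact (hp.tendsto _).comp (tendsto_const_nhds.div hc one_ne_zero)
  have := tendsto_nhds_unique (l2.congr' ?_) l1
  · rw [← this]
    simp only [one_mul, div_one]
    ring
  have hsq : ‖a‖ ^ 2 < 1 := pow_lt_one₀ (norm_nonneg _) h.norm_a two_ne_zero
  filter_upwards [Ioo_mem_nhdsLT hsq] with t ht
  have ht0 : 0 < t := (sq_nonneg _).trans_lt ht.1
  have e : ‖(t : ℂ) / a‖ = t / ‖a‖ := by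
    rw [norm_div, Complex.norm_real, Real.norm_of_nonneg ht0.le]
  have key := hC (t / a) (by rw [e, lt_div_iff₀ hna, ← pow_two]; exact ht.1)
    (by rw [e, mul_div_cancel₀ _ hna.ne']; exact ht.2)
  rw [show a⁻¹ * (t : ℂ) = t / a by ring, show b * q * a⁻¹ * (t : ℂ) = b * q * (t / a) by ring, ← key,
    mul_div_cancel₀ _ ha, show q / a * (t / a) = q / a ^ 2 * t by field_simp]
  nth_rw 2 [theta]
  rw [qProd_succ (t : ℂ) h.norm_q]
  ring

end LambertData

/-! ### Finite products of absolutely convergent series -/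

theorem hasSum_pi_prod {n : ℕ} (g : Fin n → ℤ → ℂ) (hg : ∀ j, Summable fun k => ‖g j k‖) :
    Summable (fun k : Fin n → ℤ => ‖∏ j, g j (k j)‖) ∧
      HasSum (fun k : Fin n → ℤ => ∏ j, g j (k j)) (∏ j, ∑' k, g j k) := by
  induction n with
  | zero =>
    simp only [Finset.univ_eq_empty, Finset.prod_empty]
    exact ⟨.of_finite, by simp⟩
  | succ n ih =>
    obtain ⟨h1, h2⟩ := ih (fun j => g j.succ) fun j => hg j.succ
    have e : ∀ p : ℤ × (Fin n → ℤ),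
        ∏ j, g j ((Fin.consEquiv fun _ => ℤ) p j) = g 0 p.1 * ∏ j, g j.succ (p.2 j) := fun p => by
      rw [Fin.prod_univ_succ]
      simp [Fin.consEquiv]
    constructor
    · refine (Fin.consEquiv fun _ => ℤ).summable_iff.1 (((hg 0).mul_norm h1).congr fun p => ?_)
      rw [Function.comp_apply, e]
    · refine (Fin.consEquiv fun _ => ℤ).hasSum_iff.1 ?_
      rw [Fin.prod_univ_succ]
      refine ((hg 0).of_norm.hasSum.mul h2 ((hg 0).mul_norm h1).of_norm).congr_fun fun p => ?_
      rw [Function.comp_apply, e]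

/-! ### The pfaffian of a sum of elementary matrices -/

section Algebra

variable {n : ℕ}

/-- The index of the first element of the `j`-th pair. -/
def evenIdx (j : Fin n) : Fin (2 * n) := ⟨2 * (j : ℕ), by omega⟩

/-- The index of the second element of the `j`-th pair. -/
def oddIdx (j : Fin n) : Fin (2 * n) := ⟨2 * (j : ℕ) + 1, by omega⟩

/-- Composing `σ` with the transposition of the two slots of one pair flips the sign, so
antisymmetrizing that pair doubles the signed sum. The set `t` records which pairs have been
treated. -/
theorem pair_swap_sum (u v : Fin n → Fin (2 * n) → ℂ) (t : Finset (Fin n)) :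
    ∑ σ : Equiv.Perm (Fin (2 * n)), ((Equiv.Perm.sign σ : ℤ) : ℂ) * ∏ j : Fin n,
      (u j (σ (evenIdx j)) * v j (σ (oddIdx j)) -
        if j ∈ t then v j (σ (evenIdx j)) * u j (σ (oddIdx j)) else 0) =
    2 ^ t.card * ∑ σ : Equiv.Perm (Fin (2 * n)), ((Equiv.Perm.sign σ : ℤ) : ℂ) * ∏ j : Fin n,
      (u j (σ (evenIdx j)) * v j (σ (oddIdx j))) := by
  induction t using Finset.induction_on with
  | empty => simp
  | insert a t ha ih =>
    rw [Finset.card_insert_of_notMem ha, pow_succ', mul_assoc, ← ih]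
    refine Eq.trans ?_ (two_mul _).symm
    set R : Equiv.Perm (Fin (2 * n)) → ℂ := fun σ => ∏ j ∈ Finset.univ.erase a,
      (u j (σ (evenIdx j)) * v j (σ (oddIdx j)) -
        if j ∈ t then v j (σ (evenIdx j)) * u j (σ (oddIdx j)) else 0) with hR
    have e1 : ∀ σ : Equiv.Perm (Fin (2 * n)), ∏ j : Fin n,
        (u j (σ (evenIdx j)) * v j (σ (oddIdx j)) -
          if j ∈ t then v j (σ (evenIdx j)) * u j (σ (oddIdx j)) else 0)
        = u a (σ (evenIdx a)) * v a (σ (oddIdx a)) * R σ := fun σ => by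
      rw [← Finset.mul_prod_erase _ _ (Finset.mem_univ a), if_neg ha, sub_zero]
    have e2 : ∀ σ : Equiv.Perm (Fin (2 * n)), ∏ j : Fin n,
        (u j (σ (evenIdx j)) * v j (σ (oddIdx j)) -
          if j ∈ insert a t then v j (σ (evenIdx j)) * u j (σ (oddIdx j)) else 0)
        = (u a (σ (evenIdx a)) * v a (σ (oddIdx a)) - v a (σ (evenIdx a)) * u a (σ (oddIdx a)))
          * R σ := fun σ => by
      rw [← Finset.mul_prod_erase _ _ (Finset.mem_univ a), if_pos (Finset.mem_insert_self a t), hR]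
      congr 1
      refine Finset.prod_congr rfl fun j hj => ?_
      have : j ≠ a := Finset.ne_of_mem_erase hj
      simp [Finset.mem_insert, this]
    set τ := Equiv.swap (evenIdx a) (oddIdx a) with hτ
    have hne : evenIdx a ≠ oddIdx a := by simp [evenIdx, oddIdx]
    have hRτ : ∀ σ, R (σ * τ) = R σ := fun σ => by
      refine Finset.prod_congr rfl fun j hj => ?_
      have hja : (j : ℕ) ≠ a := fun h => Finset.ne_of_mem_erase hj (Fin.ext h)
      have h1 : τ (evenIdx j) = evenIdx j := Equiv.swap_apply_of_ne_of_ne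
        (by simp only [evenIdx, ne_eq, Fin.mk.injEq]; omega)
        (by simp only [evenIdx, oddIdx, ne_eq, Fin.mk.injEq]; omega)
      have h2 : τ (oddIdx j) = oddIdx j := Equiv.swap_apply_of_ne_of_ne
        (by simp only [evenIdx, oddIdx, ne_eq, Fin.mk.injEq]; omega)
        (by simp only [oddIdx, ne_eq, Fin.mk.injEq]; omega)
      simp only [Equiv.Perm.mul_apply, h1, h2]
    simp_rw [e1, e2, sub_mul, mul_sub]
    rw [Finset.sum_sub_distrib, sub_eq_add_neg]
    congr 1
    rw [← Equiv.sum_comp (Equiv.mulRight τ), ← Finset.sum_neg_distrib]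
    refine Finset.sum_congr rfl fun σ _ => ?_
    simp only [Equiv.coe_mulRight, hRτ, Equiv.Perm.sign_mul, Equiv.Perm.mul_apply]
    rw [hτ, Equiv.swap_apply_left, Equiv.swap_apply_right, Equiv.Perm.sign_swap hne]
    push_cast
    ring

/-- The permutation taking the column order `u_n, …, u_1, v_1, …, v_n` to `u_1, v_1, u_2, v_2, …`. -/
def unfoldPerm (n : ℕ) : Equiv.Perm (Fin (2 * n)) where
  toFun l := if h : (l : ℕ) < n then ⟨2 * (n - 1 - l), by omega⟩ else ⟨2 * (l - n) + 1, by omega⟩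
  invFun m := if (m : ℕ) % 2 = 0 then ⟨n - 1 - m / 2, by omega⟩ else ⟨n + m / 2, by omega⟩
  left_inv l := by
    ext
    dsimp only
    split_ifs <;> simp_all <;> omega
  right_inv m := by
    ext
    dsimp only
    by_cases h : (m : ℕ) % 2 = 0
    · have h1 : n - 1 - (m : ℕ) / 2 < n := by omega
      simp only [h, if_true, h1, dif_pos]
      omega
    · have h1 : ¬ n + (m : ℕ) / 2 < n := by omega
      simp only [h, if_false, h1, dif_neg, not_false_eq_true]
      omega

/-- The positions inverted with `i` are exactly the `j` strictly between `i` and its mirror image: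
`2n - 2 - 2i` of them, or none in the second half. Each count is even. -/
theorem sign_unfoldPerm (n : ℕ) : Equiv.Perm.sign (unfoldPerm n) = 1 := by
  rw [Equiv.Perm.sign_eq_prod_prod_Ioi]
  refine Finset.prod_eq_one fun i _ => ?_
  have h : ∀ j ∈ Finset.Ioi i, (if unfoldPerm n i < unfoldPerm n j then (1 : ℤˣ) else -1) =
      if j < i.rev then -1 else 1 := fun j hj => by
    have hij : (i : ℕ) < j := Fin.lt_def.1 (Finset.mem_Ioi.1 hj)
    have e : unfoldPerm n i < unfoldPerm n j ↔ ¬ j < i.rev := by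
      simp only [unfoldPerm, Equiv.coe_fn_mk, Fin.lt_def, Fin.val_rev]
      split_ifs <;> simp only [] <;> omega
    simp only [e, ite_not]
  rw [Finset.prod_congr rfl h, Finset.prod_ite, Finset.prod_const, Finset.prod_const_one, mul_one]
  have e : (Finset.Ioi i).filter (fun j => j < i.rev) = Finset.Ioo i i.rev := by
    ext j; simp
  rw [e, Fin.card_Ioo, Fin.val_rev]
  refine Even.neg_one_pow ?_
  rw [Nat.even_iff]
  omega

/-- The matrix with columns `u_n, …, u_1, v_1, …, v_n`. -/
def foldedMatrix (u v : Fin n → Fin (2 * n) → ℂ) : Matrix (Fin (2 * n)) (Fin (2 * n)) ℂ :=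
  Matrix.of fun i l => Fin.append (fun j => u j.rev i) (fun j => v j i) (Fin.cast (two_mul n) l)

/-- The column positions of `u` and `v` in `foldedMatrix u v`. -/
def foldEquiv (n : ℕ) : Fin n ⊕ Fin n ≃ Fin (2 * n) :=
  ((Equiv.sumCongr Fin.revPerm (Equiv.refl _)).trans finSumFinEquiv).trans
    (finCongr (two_mul n).symm)

theorem foldedMatrix_inl (u v : Fin n → Fin (2 * n) → ℂ) (i : Fin (2 * n)) (j : Fin n) :
    foldedMatrix u v i (foldEquiv n (.inl j)) = u j i := by
  simp [foldedMatrix, foldEquiv]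

theorem foldedMatrix_inr (u v : Fin n → Fin (2 * n) → ℂ) (i : Fin (2 * n)) (j : Fin n) :
    foldedMatrix u v i (foldEquiv n (.inr j)) = v j i :=
  Fin.append_right (fun j => u j.rev i) (fun j => v j i) j

theorem unfoldPerm_inl (j : Fin n) : unfoldPerm n (foldEquiv n (.inl j)) = evenIdx j := by
  ext
  simp only [unfoldPerm, foldEquiv, evenIdx, Equiv.trans_apply, Equiv.sumCongr_apply, Sum.map_inl,
    Fin.revPerm_apply, finSumFinEquiv_apply_left, finCongr_apply, Equiv.coe_fn_mk, Fin.val_cast,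
    Fin.val_castAdd, Fin.val_rev]
  split_ifs <;> simp only [] <;> omega

theorem unfoldPerm_inr (j : Fin n) : unfoldPerm n (foldEquiv n (.inr j)) = oddIdx j := by
  ext
  simp only [unfoldPerm, foldEquiv, oddIdx, Equiv.trans_apply, Equiv.sumCongr_apply, Sum.map_inr,
    Equiv.refl_apply, finSumFinEquiv_apply_right, finCongr_apply, Equiv.coe_fn_mk, Fin.val_cast,
    Fin.val_natAdd]
  split_ifs <;> simp only [] <;> omega

theorem det_foldedMatrix (u v : Fin n → Fin (2 * n) → ℂ) :
    (foldedMatrix u v).det = ∑ σ : Equiv.Perm (Fin (2 * n)), ((Equiv.Perm.sign σ : ℤ) : ℂ) *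
      ∏ j : Fin n, (u j (σ (evenIdx j)) * v j (σ (oddIdx j))) := by
  rw [Matrix.det_apply', ← Equiv.sum_comp (Equiv.mulRight (unfoldPerm n))]
  refine Finset.sum_congr rfl fun σ _ => ?_
  rw [Equiv.coe_mulRight, Equiv.Perm.sign_mul, sign_unfoldPerm, mul_one,
    ← Equiv.prod_comp (foldEquiv n), Fintype.prod_sum_type, ← Finset.prod_mul_distrib]
  simp_rw [foldedMatrix_inl, foldedMatrix_inr, Equiv.Perm.mul_apply, unfoldPerm_inl, unfoldPerm_inr]

theorem sum_sign_prod_eq_det (u v : Fin n → Fin (2 * n) → ℂ) :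
    ∑ σ : Equiv.Perm (Fin (2 * n)), ((Equiv.Perm.sign σ : ℤ) : ℂ) * ∏ j : Fin n,
      (u j (σ (evenIdx j)) * v j (σ (oddIdx j)) - v j (σ (evenIdx j)) * u j (σ (oddIdx j)))
      = 2 ^ n * (foldedMatrix u v).det := by
  have h := pair_swap_sum u v Finset.univ
  simp only [Finset.mem_univ, if_true, Finset.card_univ, Fintype.card_fin] at h
  rw [h, det_foldedMatrix]

/-- The permutation acts on the `u` columns and on the `v` columns alike, so its sign enters
squared. -/
theorem det_foldedMatrix_comp_perm (u v : Fin n → Fin (2 * n) → ℂ) (τ : Equiv.Perm (Fin n)) :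
    (foldedMatrix (u ∘ τ) (v ∘ τ)).det = (foldedMatrix u v).det := by
  set e : Equiv.Perm (Fin (2 * n)) := (foldEquiv n).permCongr (Equiv.Perm.sumCongr τ τ) with he
  have hM : foldedMatrix (u ∘ τ) (v ∘ τ) = (foldedMatrix u v).submatrix id e := by
    ext i l
    obtain ⟨l, rfl⟩ := (foldEquiv n).surjective l
    rw [Matrix.submatrix_apply, he, Equiv.permCongr_apply, Equiv.symm_apply_apply]
    rcases l with j | j
    · rw [Equiv.Perm.sumCongr_apply, Sum.map_inl, foldedMatrix_inl, foldedMatrix_inl]; rfl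
    · rw [Equiv.Perm.sumCongr_apply, Sum.map_inr, foldedMatrix_inr, foldedMatrix_inr]; rfl
  rw [hM, Matrix.det_permute', he, Equiv.Perm.sign_permCongr, Equiv.Perm.sign_sumCongr,
    Int.units_mul_self]
  simp

theorem det_foldedMatrix_eq_zero (u v : Fin n → Fin (2 * n) → ℂ) {i j : Fin n} (hij : i ≠ j)
    (hu : u i = u j) : (foldedMatrix u v).det = 0 := by
  refine Matrix.det_zero_of_column_eq (i := foldEquiv n (.inl i)) (j := foldEquiv n (.inl j))
    (fun h => hij (Sum.inl_injective ((foldEquiv n).injective h))) fun l => ?_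
  rw [foldedMatrix_inl, foldedMatrix_inl, hu]

/-- Every perfect matching uses each index once, so a scaling `w i * w j` contributes the same
product to each term. Diagonal entries never occur, hence the restriction to `i ≠ j`. -/
theorem pfaffian_scale (C : ℂ) (w : Fin (2 * n) → ℂ) (A B : Fin (2 * n) → Fin (2 * n) → ℂ)
    (h : ∀ i j, i ≠ j → A i j = C * (w i * w j) * B i j) :
    pfaffian A = C ^ n * (∏ i, w i) * pfaffian B := by
  unfold pfaffian
  rw [mul_left_comm, Finset.mul_sum _ _ (C ^ n * ∏ i, w i)]
  congr 1
  refine Finset.sum_congr rfl fun σ _ => ?_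
  have h1 : ∀ j : Fin n, A (σ (evenIdx j)) (σ (oddIdx j)) =
      C * (w (σ (evenIdx j)) * w (σ (oddIdx j))) * B (σ (evenIdx j)) (σ (oddIdx j)) := fun j =>
    h _ _ (by simp [evenIdx, oddIdx])
  have h2 : ∏ i, w i = ∏ j : Fin n, (w (σ (evenIdx j)) * w (σ (oddIdx j))) := by
    rw [← Equiv.prod_comp σ, ← Equiv.prod_comp (unfoldPerm n), ← Equiv.prod_comp (foldEquiv n),
      Fintype.prod_sum_type, ← Finset.prod_mul_distrib]
    simp_rw [unfoldPerm_inl, unfoldPerm_inr]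
  simp only [evenIdx, oddIdx] at h1 h2
  simp_rw [h1, Finset.prod_mul_distrib, h2, Finset.prod_mul_distrib, Finset.prod_const,
    Finset.card_univ, Fintype.card_fin]
  ring

end Algebra

/-! ### The pfaffian of an infinite sum -/

section Infinite

variable {n : ℕ}

theorem incTuple_comp_injective :
    Function.Injective fun p : IncTuple n × Equiv.Perm (Fin n) => p.1.1 ∘ p.2 := by
  rintro ⟨⟨k, hk⟩, σ⟩ ⟨⟨l, hl⟩, τ⟩ h
  simp only at h
  have hkl : k = l := by
    refine (hk.2.range_inj hl.2).1 ?_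
    rw [← σ.surjective.range_comp k, h, τ.surjective.range_comp l]
  subst hkl
  have : σ = τ := Equiv.ext fun j => hk.2.injective (congrFun h j)
  rw [this]

theorem mem_range_incTuple_comp {k : Fin n → ℤ} (h1 : ∀ j, 1 ≤ k j) (hk : Function.Injective k) :
    k ∈ Set.range fun p : IncTuple n × Equiv.Perm (Fin n) => p.1.1 ∘ p.2 := by
  refine ⟨⟨⟨k ∘ Tuple.sort k, fun j => h1 _, (Tuple.monotone_sort k).strictMono_of_injective
    (hk.comp (Tuple.sort k).injective)⟩, (Tuple.sort k)⁻¹⟩, ?_⟩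
  funext j
  simp

/-- A tuple of distinct positive integers is a permutation of a unique increasing one, so the sum
fibres over increasing tuples with `n!` equal terms in each fibre. That factor cancels the `n!` in
the definition of the pfaffian. -/
theorem hasSum_incTuple {G : (Fin n → ℤ) → ℂ} {V : ℂ} (hV : HasSum G V)
    (hperm : ∀ k (τ : Equiv.Perm (Fin n)), G (k ∘ τ) = G k)
    (hinj : ∀ k, ¬ Function.Injective k → G k = 0) (hpos : ∀ k j, k j < 1 → G k = 0) :
    HasSum (fun k : IncTuple n => (n.factorial : ℂ) * G k.1) V := by
  have h1 := (incTuple_comp_injective.hasSum_iff (f := G) fun k hk => by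
    by_contra hG
    refine hk (mem_range_incTuple_comp (fun j => ?_) ?_)
    · by_contra hj
      exact hG (hpos k j (not_le.1 hj))
    · by_contra hi
      exact hG (hinj k hi)).2 hV
  refine h1.prod_fiberwise fun k => ?_
  simp only [Function.comp_def]
  have h2 := hasSum_fintype fun τ : Equiv.Perm (Fin n) => G fun x => k.1 (τ x)
  have h3 : ∀ τ : Equiv.Perm (Fin n), (G fun x => k.1 (τ x)) = G k.1 := hperm k.1
  simp_rw [h3] at h2 ⊢
  rwa [Finset.sum_const, Finset.card_univ, Fintype.card_perm, Fintype.card_fin, nsmul_eq_mul] at h2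

theorem pfaffian_hasSum (c : ℤ → ℂ) (hc : ∀ k < 1, c k = 0) (u v : ℤ → Fin (2 * n) → ℂ)
    (hs : ∀ i j, i ≠ j → Summable fun k => ‖c k * (u k i * v k j - v k i * u k j)‖) :
    HasSum (fun k : IncTuple n => (∏ j, c (k.1 j)) *
        (foldedMatrix (fun j => u (k.1 j)) (fun j => v (k.1 j))).det)
      (pfaffian fun i j => ∑' k, c k * (u k i * v k j - v k i * u k j)) := by
  set G : (Fin n → ℤ) → ℂ := fun k => 1 / (n.factorial : ℂ) * ((∏ j, c (k j)) *
    (foldedMatrix (fun j => u (k j)) (fun j => v (k j))).det) with hG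
  have hn : (n.factorial : ℂ) ≠ 0 := Nat.cast_ne_zero.2 n.factorial_ne_zero
  have h1 : HasSum G (pfaffian fun i j => ∑' k, c k * (u k i * v k j - v k i * u k j)) := by
    unfold pfaffian
    have h2 := (hasSum_sum (s := Finset.univ) fun (σ : Equiv.Perm (Fin (2 * n))) _ =>
      ((hasSum_pi_prod (fun (j : Fin n) k => c k * (u k (σ (evenIdx j)) * v k (σ (oddIdx j)) -
        v k (σ (evenIdx j)) * u k (σ (oddIdx j)))) fun j => hs _ _ (by simp [evenIdx, oddIdx])).2
          ).mul_left ((Equiv.Perm.sign σ : ℤ) : ℂ)).mul_left (1 / (2 ^ n * (n.factorial : ℂ)))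
    refine h2.congr_fun fun k => ?_
    simp_rw [Finset.prod_mul_distrib, mul_left_comm _ (∏ j, c (k j)), ← Finset.mul_sum]
    rw [sum_sign_prod_eq_det (fun j => u (k j)) fun j => v (k j), hG]
    field_simp
  have h3 := hasSum_incTuple h1 (fun k τ => ?_) (fun k hk => ?_) fun k j hj => ?_
  · refine h3.congr_fun fun k => ?_
    rw [hG]
    field_simp
  · have h4 := det_foldedMatrix_comp_perm (fun j => u (k j)) (fun j => v (k j)) τ
    have h5 := Equiv.prod_comp τ fun j => c (k j)
    simp only [Function.comp_def] at h4 ⊢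
    rw [hG]
    simp only
    rw [h4, h5]
  · simp only [Function.Injective, not_forall] at hk
    obtain ⟨i, j, hij, hne⟩ := hk
    rw [hG]
    simp only
    rw [det_foldedMatrix_eq_zero _ _ hne (by rw [hij]), mul_zero, mul_zero]
  · rw [hG]
    simp only
    rw [Finset.prod_eq_zero (Finset.mem_univ j) (hc _ hj), zero_mul, mul_zero]

theorem det_foldedMatrix_zpow (s : ℤ) (k : Fin n → ℤ) (y : Fin (2 * n) → ℂ) :
    (foldedMatrix (fun j i => y i ^ (k j - s)) (fun j i => y i ^ (-k j))).det
      = alternant (expVec s k) y := by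
  unfold alternant
  congr 1
  ext i l
  obtain ⟨l, rfl⟩ := (foldEquiv n).surjective l
  rcases l with j | j
  · rw [foldedMatrix_inl]
    simp [expVec, foldEquiv]
  · rw [foldedMatrix_inr]
    exact congrArg (y i ^ ·) (Fin.append_right (fun j => k j.rev - s) (fun j => -k j) j).symm

end Infinite

/-! ### Pfaffians of Lambert-type series -/

theorem xVar_ne_zero {m : ℕ} (z : Fin m → ℂ) (j : Fin m) : xVar z j ≠ 0 := Complex.exp_ne_zero _

namespace LambertData

variable {q a b c : ℂ} {s : ℤ} (h : LambertData q a b c s)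
include h

theorem lambert_eq_zero (hs : s = 0 ∨ s = 1) {k : ℤ} (h1 : k < 1) (h2 : s - k < 1) :
    lambert q a b c k = 0 := by
  have e : s - k = k := by omega
  have := h.lambert_reflect k
  rw [e] at this
  exact self_eq_neg.1 this

theorem folded_hasSum (hs : s = 0 ∨ s = 1) (γ : ℂ) {t : ℂ} (h1 : ‖a‖ < ‖t‖) (h2 : ‖a‖ * ‖t‖ < 1) :
    (Summable fun k : ℤ => ‖(if 1 ≤ k then γ * lambert q a b c k else 0) * (t ^ k - t ^ (s - k))‖) ∧
      HasSum (fun k : ℤ => (if 1 ≤ k then γ * lambert q a b c k else 0) * (t ^ k - t ^ (s - k)))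
        (γ * ∑' k, lambert q a b c k * t ^ k) := by
  have hL := (h.lambert_summable h1 h2).of_norm.mul_left γ
  set A : ℤ → ℂ := fun k => if 1 ≤ k then γ * (lambert q a b c k * t ^ k) else 0 with hA
  set B : ℤ → ℂ := fun k => if 1 ≤ s - k then γ * (lambert q a b c k * t ^ k) else 0 with hB
  have sA : Summable A := Summable.of_norm_bounded hL.norm fun k => by
    rw [hA]; dsimp only; split_ifs
    · exact le_rfl
    · rw [norm_zero]; exact norm_nonneg _
  have sB : Summable B := Summable.of_norm_bounded hL.norm fun k => by
    rw [hB]; dsimp only; split_ifs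
    · exact le_rfl
    · rw [norm_zero]; exact norm_nonneg _
  have hB' : HasSum (fun k => B (s - k)) (∑' k, B k) :=
    ((Equiv.subLeft s).hasSum_iff (f := B)).2 sB.hasSum
  have e1 : ∀ k : ℤ, (if 1 ≤ k then γ * lambert q a b c k else 0) * (t ^ k - t ^ (s - k))
      = A k + B (s - k) := fun k => by
    rw [hA, hB]
    simp only [sub_sub_cancel, h.lambert_reflect]
    split_ifs <;> ring
  have e2 : ∀ k, A k + B k = γ * (lambert q a b c k * t ^ k) := fun k => by
    rw [hA, hB]
    dsimp only
    split_ifs with h3 h4 h4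
    · omega
    · ring
    · ring
    · rw [h.lambert_eq_zero hs (by omega) (by omega)]; ring
  -- `A` carries the indices `k ≥ 1` and `B` their mirror images under `k ↦ s - k`. For `s = 1`
  -- these exhaust the integers; for `s = 0` only `k = 0` is missed, and its coefficient is zero by
  -- antisymmetry.
  simp_rw [e1]
  have hsum := sA.hasSum.add hB'
  refine ⟨hsum.summable.norm, ?_⟩
  have hv : ∑' k, A k + ∑' k, B k = γ * ∑' k, lambert q a b c k * t ^ k := by
    rw [← sA.tsum_add sB, ← tsum_mul_left]
    exact tsum_congr e2
  rwa [hv] at hsum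

theorem pfaffian_expansion {n : ℕ} (hs : s = 0 ∨ s = 1) {γ : ℂ} {coeff : ℤ → ℂ}
    (hcoeff : ∀ k, coeff k = γ * lambert q a b c k) {y : Fin (2 * n) → ℂ} (hy : ∀ i, y i ≠ 0)
    (hya : ∀ i j, ‖a‖ * ‖y j‖ < ‖y i‖) :
    HasSum (fun k : IncTuple n => (∏ j, coeff (k.1 j)) * alternant (expVec s k.1) y)
      (pfaffian fun i j => (y i ^ s)⁻¹ * (γ * ∑' k, lambert q a b c k * (y i / y j) ^ k)) := by
  have hyn : ∀ i, 0 < ‖y i‖ := fun i => norm_pos_iff.2 (hy i)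
  have hF := fun i j => h.folded_hasSum hs γ (t := y i / y j)
    (by rw [norm_div, lt_div_iff₀ (hyn j)]; exact hya i j)
    (by rw [norm_div, ← mul_div_assoc, div_lt_one (hyn j)]; exact hya j i)
  set c' : ℤ → ℂ := fun k => if 1 ≤ k then γ * lambert q a b c k else 0 with hc'
  have e : ∀ i j k, c' k * (y i ^ (k - s) * y j ^ (-k) - y i ^ (-k) * y j ^ (k - s))
      = (y i ^ s)⁻¹ * (c' k * ((y i / y j) ^ k - (y i / y j) ^ (s - k))) := fun i j k => by
    have := zpow_ne_zero k (hy i)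
    have := zpow_ne_zero k (hy j)
    have := zpow_ne_zero s (hy i)
    have := zpow_ne_zero s (hy j)
    rw [zpow_sub₀ (hy i), zpow_sub₀ (hy j), zpow_neg, zpow_neg, div_zpow, div_zpow,
      zpow_sub₀ (hy i), zpow_sub₀ (hy j)]
    field_simp
  have key := pfaffian_hasSum (n := n) c' (fun k hk => by rw [hc']; exact if_neg (not_le.2 hk))
    (fun k i => y i ^ (k - s)) (fun k i => y i ^ (-k)) fun i j _ => by
      refine ((hF i j).1.mul_left ‖(y i ^ s)⁻¹‖).congr fun k => ?_
      rw [← norm_mul, ← e]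
  have hT : ∀ i j, ∑' k, c' k * ((y i / y j) ^ k - (y i / y j) ^ (s - k))
      = γ * ∑' k, lambert q a b c k * (y i / y j) ^ k := fun i j => (hF i j).2.tsum_eq
  simp_rw [e, tsum_mul_left, hT] at key
  refine key.congr_fun fun k => ?_
  rw [det_foldedMatrix_zpow]
  congr 1
  refine Finset.prod_congr rfl fun j _ => ?_
  rw [hc', hcoeff]
  simp [k.2.1 j]

/-- `hC` is the single numerical condition tying the prescribed constant `C` and the normalization
`γ` of the coefficients to the value found in `lambert_eq_theta`. -/
theorem entry_eq {C γ t : ℂ} (h1 : ‖a‖ < ‖t‖) (h2 : ‖a‖ * ‖t‖ < 1)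
    (hC : C * γ * (qProd q q ^ 2 * theta (q / a ^ 2) q) = -a⁻¹ * theta a q * theta (b * q / a) q) :
    C * (γ * ∑' k, lambert q a b c k * t ^ k) * (theta (a * t) q * theta (q / a * t) q)
      = theta t q * theta (b * q * t) q := by
  have hne : -a⁻¹ * theta a q * theta (b * q / a) q ≠ 0 :=
    mul_ne_zero (mul_ne_zero (neg_ne_zero.2 (inv_ne_zero h.a_ne_zero)) h.theta_a) h.theta_b
  have key := h.lambert_eq_theta h1 h2
  refine mul_right_cancel₀ hne ?_
  linear_combination C * γ * key + theta t q * theta (b * q * t) q * hC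

/-- The expansion of a pfaffian whose entries are the theta quotients attached to the data. -/
theorem prefactor_mul_pfaffian {n : ℕ} (hs : s = 0 ∨ s = 1) {C γ : ℂ} {coeff : ℤ → ℂ}
    (hC : C * γ * (qProd q q ^ 2 * theta (q / a ^ 2) q) = -a⁻¹ * theta a q * theta (b * q / a) q)
    (hcoeff : ∀ k, coeff k = γ * lambert q a b c k) {z : Fin (2 * n) → ℂ}
    (hya : ∀ i j, ‖a‖ * ‖xVar z j ^ 2‖ < ‖xVar z i ^ 2‖) {F : ℂ} {w : Fin (2 * n) → ℂ}
    {A : Fin (2 * n) → Fin (2 * n) → ℂ}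
    (hA : F ≠ 0 → ∀ i j, i ≠ j → A i j * (theta (a * (xVar z i ^ 2 / xVar z j ^ 2)) q *
        theta (q / a * (xVar z i ^ 2 / xVar z j ^ 2)) q)
      = w i * w j * ((xVar z i ^ 2) ^ s)⁻¹ * (theta (xVar z i ^ 2 / xVar z j ^ 2) q *
        theta (b * q * (xVar z i ^ 2 / xVar z j ^ 2)) q)) :
    Summable (term coeff s z) ∧
      F * pfaffian A = C ^ n * (∏ i, w i) * F * ∑' k : IncTuple n, term coeff s z k := by
  have hy : ∀ i, xVar z i ^ 2 ≠ 0 := fun i => pow_ne_zero 2 (xVar_ne_zero z i)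
  have key : HasSum (term coeff s z) _ := h.pfaffian_expansion hs hcoeff hy hya
  refine ⟨key.summable, ?_⟩
  rw [key.tsum_eq]
  -- If the prefactor vanishes, both sides are zero whatever the entries are. Thus the entries only
  -- need to be correct when `F ≠ 0`, which is what σ = 3 requires at `x_i² = -x_j²`.
  rcases eq_or_ne F 0 with rfl | hF
  · simp
  rw [pfaffian_scale C w A _ fun i j hij => ?_]
  · ring
  have hjn := norm_pos_iff.2 (hy j)
  have h1 : ‖a‖ < ‖xVar z i ^ 2 / xVar z j ^ 2‖ := by
    rw [norm_div, lt_div_iff₀ hjn]; exact hya i j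
  have h2 : ‖a‖ * ‖xVar z i ^ 2 / xVar z j ^ 2‖ < 1 := by
    rw [norm_div, ← mul_div_assoc, div_lt_one hjn]; exact hya j i
  have ha := norm_pos_iff.2 h.a_ne_zero
  have hE := h.entry_eq h1 h2 hC
  have hD : theta (a * (xVar z i ^ 2 / xVar z j ^ 2)) q *
      theta (q / a * (xVar z i ^ 2 / xVar z j ^ 2)) q ≠ 0 := by
    refine mul_ne_zero (theta_ne_zero_of_norm h.norm_q (by rwa [norm_mul]) ?_)
      (theta_ne_zero_of_norm h.norm_q ?_ ?_)
    · have := h.norm_q_div.trans_lt h1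
      rwa [norm_div, div_lt_iff₀ ha, mul_comm, ← norm_mul] at this
    · rw [norm_mul]
      exact (mul_le_mul_of_nonneg_right h.norm_q_div (norm_nonneg _)).trans_lt h2
    · rw [norm_mul, norm_div q, div_mul_eq_mul_div, lt_div_iff₀ ha]
      exact mul_lt_mul_of_pos_left h1 (norm_pos_iff.2 h.q_ne_zero)
  refine mul_right_cancel₀ hD ?_
  rw [hA hF i j hij, ← hE]
  ring

end LambertData

/-! ### Product identities -/

theorem theta_cubic_base {ρ x : ℂ} (hρ0 : ρ ≠ 0) (hρ : ‖ρ‖ < 1) (hx : x ≠ 0) :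
    theta x ρ = theta x (ρ ^ 3) * theta (ρ * x) (ρ ^ 3) * theta (ρ ^ 2 * x) (ρ ^ 3) := by
  unfold theta
  rw [qProd_three x hρ, qProd_three (ρ / x) hρ, show ρ / x * ρ = ρ ^ 3 / (ρ * x) by field_simp,
    show ρ / x * ρ ^ 2 = ρ ^ 3 / x by field_simp, show ρ / x = ρ ^ 3 / (ρ ^ 2 * x) by field_simp,
    mul_comm x ρ, mul_comm x (ρ ^ 2)]
  ring

theorem theta_cube {ω : ℂ} (hω : ω ^ 2 + ω + 1 = 0) {q x : ℂ} (hq : ‖q‖ < 1) (hx : x ≠ 0) :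
    theta (x ^ 3) (q ^ 3) = theta x q * theta (ω * x) q * theta (ω ^ 2 * x) q := by
  have h3 : ω ^ 3 = 1 := by linear_combination (ω - 1) * hω
  have hω0 : ω ≠ 0 := fun h0 => by simp [h0] at hω
  have e1 : q / (ω * x) = ω ^ 2 * (q / x) := by
    field_simp
    linear_combination -q * h3
  have e2 : q / (ω ^ 2 * x) = ω * (q / x) := by
    field_simp
    linear_combination -q * h3
  unfold theta
  rw [← div_pow, ← qProd_mul_cube hω x hq, ← qProd_mul_cube hω (q / x) hq, e1, e2]
  ring

theorem norm_pow_lt_one {r : ℂ} (hr : ‖r‖ < 1) {m : ℕ} (hm : m ≠ 0) : ‖r ^ m‖ < 1 := by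
  rw [norm_pow]; exact pow_lt_one₀ (norm_nonneg _) hr hm

theorem qProd_pow_ne_zero {r : ℂ} (hr : ‖r‖ < 1) {i m : ℕ} (hi : i ≠ 0) (hm : m ≠ 0) :
    qProd (r ^ i) (r ^ m) ≠ 0 :=
  qProd_ne_zero_of_norm_lt (norm_pow_lt_one hr hm) (norm_pow_lt_one hr hi)

theorem qProd_mul_neg_pow {r : ℂ} (hr : ‖r‖ < 1) (i : ℕ) :
    qProd (r ^ i) (r ^ 6) * qProd (-r ^ i) (r ^ 6) = qProd (r ^ (2 * i)) (r ^ 12) := by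
  rw [qProd_mul_neg _ (norm_pow_lt_one hr (by norm_num))]
  ring_nf

theorem qProd_two_pow {r : ℂ} (hr : ‖r‖ < 1) (i : ℕ) :
    qProd (r ^ i) (r ^ 6) = qProd (r ^ i) (r ^ 12) * qProd (r ^ (i + 6)) (r ^ 12) := by
  rw [qProd_two _ (norm_pow_lt_one hr (by norm_num))]
  ring_nf

/-- All products are split by residues modulo 6. Pairing `(r^i; r⁶)` with `(-r^i; r⁶)` for `i = 1,
2, 4, 5` gives `(r², r⁴, r⁸, r¹⁰; r¹²)`, which regroups to `(r², r⁴; r⁶)`. -/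
theorem product_identity_sextic {r : ℂ} (hr : ‖r‖ < 1) :
    qProd (r ^ 3) (r ^ 3) * (qProd (r ^ 4) (r ^ 6) * qProd (r ^ 2) (r ^ 6)) =
      qProd r r * (qProd (-r) (r ^ 6) * qProd (-r ^ 5) (r ^ 6)) *
        (qProd (-r ^ 2) (r ^ 6) * qProd (-r ^ 4) (r ^ 6)) := by
  have e1 : qProd (r ^ 3) (r ^ 3) = qProd (r ^ 3) (r ^ 6) * qProd (r ^ 6) (r ^ 6) := by
    rw [qProd_two _ (norm_pow_lt_one hr (by norm_num))]
    ring_nf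
  have e2 : qProd r r = qProd r (r ^ 6) * qProd (r ^ 2) (r ^ 6) * qProd (r ^ 3) (r ^ 6) *
      qProd (r ^ 4) (r ^ 6) * qProd (r ^ 5) (r ^ 6) * qProd (r ^ 6) (r ^ 6) := by
    rw [qProd_split 6 (by norm_num) r hr]
    simp only [Finset.prod_range_succ, Finset.prod_range_zero, pow_zero, mul_one, one_mul]
    ring_nf
  have e3 := qProd_mul_neg_pow hr 1
  have e4 := qProd_mul_neg_pow hr 2
  have e5 := qProd_mul_neg_pow hr 4
  have e6 := qProd_mul_neg_pow hr 5
  have e7 := qProd_two_pow hr 2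
  have e8 := qProd_two_pow hr 4
  norm_num at e3 e4 e5 e6 e7 e8
  rw [e1, e2]
  calc _ = qProd (r ^ 3) (r ^ 6) * qProd (r ^ 6) (r ^ 6) *
        ((qProd (r ^ 4) (r ^ 12) * qProd (r ^ 10) (r ^ 12)) *
        (qProd (r ^ 2) (r ^ 12) * qProd (r ^ 8) (r ^ 12))) := by rw [e7, e8]
    _ = _ := by rw [← e6, ← e3, ← e4, ← e5]; ring

theorem product_identity_quartic {r : ℂ} (hr : ‖r‖ < 1) :
    qProd (r ^ 12) (r ^ 12) * (qProd (r ^ 4) (r ^ 6) * qProd (r ^ 2) (r ^ 6)) =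
      qProd (r ^ 4) (r ^ 4) * (qProd r (r ^ 6) * qProd (r ^ 5) (r ^ 6)) *
        (qProd (-r) (r ^ 6) * qProd (-r ^ 5) (r ^ 6)) := by
  have e1 : qProd (r ^ 4) (r ^ 4) = qProd (r ^ 4) (r ^ 12) * qProd (r ^ 8) (r ^ 12) *
      qProd (r ^ 12) (r ^ 12) := by
    rw [qProd_three _ (norm_pow_lt_one hr (by norm_num))]
    ring_nf
  have e3 := qProd_mul_neg_pow hr 1
  have e6 := qProd_mul_neg_pow hr 5
  have e7 := qProd_two_pow hr 2
  have e8 := qProd_two_pow hr 4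
  norm_num at e3 e6 e7 e8
  rw [e1, e7, e8]
  linear_combination (-qProd (r ^ 4) (r ^ 12) * qProd (r ^ 8) (r ^ 12) *
      qProd (r ^ 12) (r ^ 12)) * (qProd (r ^ 5) (r ^ 6) * qProd (-r ^ 5) (r ^ 6) * e3 +
        qProd (r ^ 2) (r ^ 12) * e6)

/-- Euler's identity `(x; x²)_∞ (-x; x)_∞ = 1`. -/
theorem qProd_euler {x : ℂ} (hx : ‖x‖ < 1) : qProd x (x ^ 2) * qProd (-x) x = 1 := by
  have h1 := qProd_two x hx
  have h2 := qProd_mul_neg x hx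
  have h3 : qProd x x ≠ 0 := qProd_ne_zero_of_norm_lt hx hx
  have h4 : qProd (x ^ 2) (x ^ 2) ≠ 0 := qProd_pow_ne_zero hx two_ne_zero two_ne_zero
  refine mul_right_cancel₀ h4 ?_
  rw [← pow_two] at h1
  linear_combination h2 - qProd (-x) x * h1

theorem product_identity_cubic_even {ω : ℂ} (hω : ω ^ 2 + ω + 1 = 0) {p : ℂ} (hp : ‖p‖ < 1) :
    qProd (p ^ 4) (p ^ 4) * (qProd (ω * p ^ 2) (p ^ 2) * qProd (ω ^ 2 * p ^ 2) (p ^ 2)) =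
      qProd (p ^ 12) (p ^ 12) * (qProd (ω * p) (p ^ 2) * qProd (ω ^ 2 * p) (p ^ 2)) *
        (qProd (ω ^ 2 * -p) (p ^ 2) * qProd (ω * -p) (p ^ 2)) := by
  have hp2 : ‖p ^ 2‖ < 1 := norm_pow_lt_one hp two_ne_zero
  have hp6 : ‖p ^ 6‖ < 1 := norm_pow_lt_one hp (by norm_num)
  have c1 : qProd p (p ^ 2) * qProd (ω * p) (p ^ 2) * qProd (ω ^ 2 * p) (p ^ 2)
      = qProd (p ^ 3) (p ^ 6) := by
    rw [qProd_mul_cube hω p hp2]; ring_nf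
  have c2 : qProd (-p) (p ^ 2) * qProd (ω * -p) (p ^ 2) * qProd (ω ^ 2 * -p) (p ^ 2)
      = qProd (-p ^ 3) (p ^ 6) := by
    rw [qProd_mul_cube hω (-p) hp2]; ring_nf
  have c3 : qProd (p ^ 2) (p ^ 2) * qProd (ω * p ^ 2) (p ^ 2) * qProd (ω ^ 2 * p ^ 2) (p ^ 2)
      = qProd (p ^ 6) (p ^ 6) := by
    rw [qProd_mul_cube hω (p ^ 2) hp2]; ring_nf
  have n1 : qProd p (p ^ 2) * qProd (-p) (p ^ 2) = qProd (p ^ 2) (p ^ 4) := by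
    rw [qProd_mul_neg p hp2]; ring_nf
  have n2 : qProd (p ^ 3) (p ^ 6) * qProd (-p ^ 3) (p ^ 6) = qProd (p ^ 6) (p ^ 12) := by
    rw [qProd_mul_neg _ hp6]; ring_nf
  have t1 : qProd (p ^ 2) (p ^ 2) = qProd (p ^ 2) (p ^ 4) * qProd (p ^ 4) (p ^ 4) := by
    rw [qProd_two _ hp2]; ring_nf
  have t2 : qProd (p ^ 6) (p ^ 6) = qProd (p ^ 6) (p ^ 12) * qProd (p ^ 12) (p ^ 12) := by
    rw [qProd_two _ hp6]; ring_nf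
  have z1 : qProd (p ^ 2) (p ^ 2) ≠ 0 := qProd_pow_ne_zero hp two_ne_zero two_ne_zero
  have z2 : qProd p (p ^ 2) ≠ 0 := qProd_ne_zero_of_norm_lt hp2 hp
  have z3 : qProd (-p) (p ^ 2) ≠ 0 := qProd_ne_zero_of_norm_lt hp2 (by rwa [norm_neg])
  -- Multiplying by the factors without `ω` completes each pair to a full orbit under cube roots of
  -- unity, which collapses to a product in the cubed variables.
  refine mul_right_cancel₀ (mul_ne_zero (mul_ne_zero z1 z2) z3) ?_
  calc _ = qProd (p ^ 4) (p ^ 4) *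
        (qProd (p ^ 2) (p ^ 2) * qProd (ω * p ^ 2) (p ^ 2) * qProd (ω ^ 2 * p ^ 2) (p ^ 2)) *
        (qProd p (p ^ 2) * qProd (-p) (p ^ 2)) := by ring
    _ = qProd (p ^ 12) (p ^ 12) * qProd (p ^ 2) (p ^ 2) *
        (qProd (p ^ 3) (p ^ 6) * qProd (-p ^ 3) (p ^ 6)) := by rw [c3, n1, n2, t1, t2]; ring
    _ = _ := by rw [← c1, ← c2]; ring

theorem product_identity_cubic_odd {ω : ℂ} (hω : ω ^ 2 + ω + 1 = 0) {p : ℂ} (hp : ‖p‖ < 1) :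
    qProd (-p) (-p) * (qProd (ω * p ^ 2) (p ^ 2) * qProd (ω ^ 2 * p ^ 2) (p ^ 2)) =
      qProd (-p ^ 3) (-p ^ 3) * (qProd (ω * p) (p ^ 2) * qProd (ω ^ 2 * p) (p ^ 2)) *
        (qProd (ω ^ 2 * -p ^ 2) (p ^ 2) * qProd (ω * -p ^ 2) (p ^ 2)) := by
  have hp2 : ‖p ^ 2‖ < 1 := norm_pow_lt_one hp two_ne_zero
  have hp3 : ‖p ^ 3‖ < 1 := norm_pow_lt_one hp (by norm_num)
  have hp6 : ‖p ^ 6‖ < 1 := norm_pow_lt_one hp (by norm_num)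
  have c1 : qProd p (p ^ 2) * qProd (ω * p) (p ^ 2) * qProd (ω ^ 2 * p) (p ^ 2)
      = qProd (p ^ 3) (p ^ 6) := by
    rw [qProd_mul_cube hω p hp2]; ring_nf
  have c2 : qProd (-p ^ 2) (p ^ 2) * qProd (ω * -p ^ 2) (p ^ 2) * qProd (ω ^ 2 * -p ^ 2) (p ^ 2)
      = qProd (-p ^ 6) (p ^ 6) := by
    rw [qProd_mul_cube hω (-p ^ 2) hp2]; ring_nf
  have c3 : qProd (p ^ 2) (p ^ 2) * qProd (ω * p ^ 2) (p ^ 2) * qProd (ω ^ 2 * p ^ 2) (p ^ 2)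
      = qProd (p ^ 6) (p ^ 6) := by
    rw [qProd_mul_cube hω (p ^ 2) hp2]; ring_nf
  have n1 : qProd p (p ^ 2) * qProd (-p) (p ^ 2) = qProd (p ^ 2) (p ^ 4) := by
    rw [qProd_mul_neg p hp2]; ring_nf
  have n2 : qProd (p ^ 3) (p ^ 6) * qProd (-p ^ 3) (p ^ 6) = qProd (p ^ 6) (p ^ 12) := by
    rw [qProd_mul_neg _ hp6]; ring_nf
  have t1 : qProd (-p) (-p) = qProd (-p) (p ^ 2) * qProd (p ^ 2) (p ^ 2) := by
    rw [qProd_two _ (by rwa [norm_neg])]; ring_nf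
  have t2 : qProd (-p ^ 3) (-p ^ 3) = qProd (-p ^ 3) (p ^ 6) * qProd (p ^ 6) (p ^ 6) := by
    rw [qProd_two _ (by rwa [norm_neg])]; ring_nf
  have E1 : qProd (p ^ 2) (p ^ 4) * qProd (-p ^ 2) (p ^ 2) = 1 := by
    rw [← qProd_euler hp2]; ring_nf
  have E2 : qProd (p ^ 6) (p ^ 12) * qProd (-p ^ 6) (p ^ 6) = 1 := by
    rw [← qProd_euler hp6]; ring_nf
  have z1 : qProd (p ^ 2) (p ^ 2) ≠ 0 := qProd_pow_ne_zero hp two_ne_zero two_ne_zero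
  have z2 : qProd p (p ^ 2) ≠ 0 := qProd_ne_zero_of_norm_lt hp2 hp
  have z3 : qProd (-p ^ 2) (p ^ 2) ≠ 0 := qProd_ne_zero_of_norm_lt hp2 (by rwa [norm_neg])
  -- The same completion of orbits applies; the leftover factors cancel by Euler's identity, for
  -- `p²` and for `p⁶`.
  refine mul_right_cancel₀ (mul_ne_zero (mul_ne_zero z1 z2) z3) ?_
  calc _ = qProd (p ^ 2) (p ^ 2) *
        (qProd (p ^ 2) (p ^ 2) * qProd (ω * p ^ 2) (p ^ 2) * qProd (ω ^ 2 * p ^ 2) (p ^ 2)) *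
        (qProd p (p ^ 2) * qProd (-p) (p ^ 2) * qProd (-p ^ 2) (p ^ 2)) := by rw [t1]; ring
    _ = qProd (p ^ 2) (p ^ 2) * qProd (p ^ 6) (p ^ 6) *
        (qProd (p ^ 3) (p ^ 6) * qProd (-p ^ 3) (p ^ 6) * qProd (-p ^ 6) (p ^ 6)) := by
      rw [c3, n1, n2, E1, E2]
    _ = _ := by rw [t2, ← c1, ← c2]; ring

/-! ### The five specializations -/

theorem norm_zpow_ne_one {r : ℂ} (hr0 : r ≠ 0) (hr : ‖r‖ < 1) {e : ℤ} (he : e ≠ 0) :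
    ‖r ^ e‖ ≠ 1 := by
  rw [norm_zpow]
  intro h
  have hp := norm_pos_iff.2 hr0
  rcases (zpow_eq_one_iff_of_ne_zero₀ he).1 h with h1 | h1
  · exact hr.ne h1
  · linarith [h1.1]

theorem pow_zpow_swap (r : ℂ) (m : ℕ) (k : ℤ) : (r ^ m) ^ k = (r ^ k) ^ m := by
  rw [← zpow_natCast, ← zpow_natCast, zpow_comm]

section Nome

variable {r : ℂ} (hr0 : r ≠ 0) (hr : ‖r‖ < 1)
include hr0 hr

theorem theta_pow_ne_zero {d : ℂ} {m : ℕ} (hd : ‖d‖ = ‖r‖ ^ m) (h1 : 0 < m) (h2 : m < 6) :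
    theta d (r ^ 6) ≠ 0 := by
  refine theta_ne_zero_of_norm (norm_pow_lt_one hr (by norm_num)) ?_ ?_
  · rw [hd]; exact pow_lt_one₀ (norm_nonneg _) hr h1.ne'
  · rw [hd, norm_pow]; exact pow_lt_pow_right_of_lt_one₀ (norm_pos_iff.2 hr0) hr h2

theorem theta_mul_ne_zero {d t : ℂ} {m : ℕ} (hd : ‖d‖ = ‖r‖ ^ m) (h1 : 1 ≤ m) (h2 : m ≤ 5)
    (ht1 : ‖r‖ < ‖t‖) (ht2 : ‖r‖ * ‖t‖ < 1) : theta (d * t) (r ^ 6) ≠ 0 := by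
  have hp := norm_pos_iff.2 hr0
  refine theta_ne_zero_of_norm (norm_pow_lt_one hr (by norm_num)) ?_ ?_
  · rw [norm_mul, hd]
    refine (mul_le_mul_of_nonneg_right ?_ (norm_nonneg t)).trans_lt ht2
    exact pow_le_of_le_one hp.le hr.le (by omega)
  · rw [norm_mul, hd, norm_pow, pow_succ]
    exact mul_lt_mul' (pow_le_pow_of_le_one hp.le hr.le h2) ht1 hp.le (pow_pos hp m)

theorem lambertData_zero : LambertData (r ^ 6) r (-1) 1 0 where
  q_ne_zero := pow_ne_zero 6 hr0
  norm_q := norm_pow_lt_one hr (by norm_num)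
  a_ne_zero := hr0
  norm_a := hr
  norm_q_div := by
    rw [show r ^ 6 / r = r ^ 5 by field_simp, norm_pow]
    exact pow_le_of_le_one (norm_nonneg _) hr.le (by norm_num)
  sq_ne := by
    rw [show r ^ 6 / r ^ 2 = r ^ 4 by field_simp]
    intro h
    exact (norm_pow_lt_one hr (m := 4) (by norm_num)).ne (by rw [h, norm_one])
  b_ne_zero := by norm_num
  b_ne k := by
    rw [pow_zpow_swap, ← pow_zpow_swap, ← zpow_natCast, ← zpow_mul]
    rcases eq_or_ne k 0 with rfl | hk
    · norm_num
    · intro h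
      refine norm_zpow_ne_one hr0 hr (e := (6 : ℕ) * k) (by positivity) ?_
      rw [← norm_neg, ← neg_one_mul, h, norm_one]
  b_sq := by norm_num
  c_eq := by norm_num
  theta_a := theta_pow_ne_zero hr0 hr (m := 1) (by simp) (by norm_num) (by norm_num)
  theta_b := theta_pow_ne_zero hr0 hr (m := 5)
    (by rw [show -1 * r ^ 6 / r = -r ^ 5 by field_simp, norm_neg, norm_pow])
    (by norm_num) (by norm_num)

/-- The modulus is `|r|^{6k-3}`, and `6k - 3` is never zero. -/
theorem inv_pow_mul_zpow_ne_one {b : ℂ} (hb : ‖b‖ = (‖r‖ ^ 3)⁻¹) (k : ℤ) : b * (r ^ 6) ^ k ≠ 1 := by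
  intro h
  refine norm_zpow_ne_one hr0 hr (e := (6 : ℕ) * k - (3 : ℕ)) (by omega) ?_
  have h1 := congrArg norm h
  rw [norm_mul, hb, norm_one] at h1
  rw [zpow_sub₀ hr0, zpow_mul, zpow_natCast, zpow_natCast, norm_div, norm_pow r 3,
    div_eq_inv_mul, h1]

theorem lambertData_six : LambertData (r ^ 6) r (-(r ^ 3)⁻¹) (r ^ 2)⁻¹ 1 where
  q_ne_zero := pow_ne_zero 6 hr0
  norm_q := norm_pow_lt_one hr (by norm_num)
  a_ne_zero := hr0
  norm_a := hr
  norm_q_div := (lambertData_zero hr0 hr).norm_q_div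
  sq_ne := (lambertData_zero hr0 hr).sq_ne
  b_ne_zero := neg_ne_zero.2 (inv_ne_zero (pow_ne_zero 3 hr0))
  b_ne := inv_pow_mul_zpow_ne_one hr0 hr (by rw [norm_neg, norm_inv, norm_pow])
  b_sq := by
    rw [zpow_one]
    field_simp
  c_eq := by
    rw [zpow_one]
    field_simp
  theta_a := (lambertData_zero hr0 hr).theta_a
  theta_b := theta_pow_ne_zero hr0 hr (m := 2)
    (by rw [show -(r ^ 3)⁻¹ * r ^ 6 / r = -r ^ 2 by field_simp, norm_neg, norm_pow])
    (by norm_num) (by norm_num)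

theorem lambertData_three : LambertData (r ^ 6) (-r ^ 2) (r ^ 3)⁻¹ r⁻¹ 1 where
  q_ne_zero := pow_ne_zero 6 hr0
  norm_q := norm_pow_lt_one hr (by norm_num)
  a_ne_zero := neg_ne_zero.2 (pow_ne_zero 2 hr0)
  norm_a := by rw [norm_neg]; exact norm_pow_lt_one hr (by norm_num)
  norm_q_div := by
    rw [show r ^ 6 / -r ^ 2 = -r ^ 4 by field_simp, norm_neg, norm_neg, norm_pow, norm_pow]
    exact pow_le_pow_of_le_one (norm_nonneg _) hr.le (by norm_num)
  sq_ne := by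
    rw [show r ^ 6 / (-r ^ 2) ^ 2 = r ^ 2 by field_simp]
    intro h
    exact (norm_pow_lt_one hr (m := 2) (by norm_num)).ne (by rw [h, norm_one])
  b_ne_zero := inv_ne_zero (pow_ne_zero 3 hr0)
  b_ne := inv_pow_mul_zpow_ne_one hr0 hr (by rw [norm_inv, norm_pow])
  b_sq := by
    rw [zpow_one]
    field_simp
  c_eq := by
    rw [zpow_one]
    field_simp
  theta_a := theta_pow_ne_zero hr0 hr (m := 2) (by rw [norm_neg, norm_pow])
    (by norm_num) (by norm_num)
  theta_b := theta_pow_ne_zero hr0 hr (m := 1)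
    (by rw [show (r ^ 3)⁻¹ * r ^ 6 / -r ^ 2 = -r by field_simp, norm_neg, pow_one])
    (by norm_num) (by norm_num)

/-! ### Specializations built on a primitive cube root of unity (σ = 2, 4) -/

section Cubic

variable {ω : ℂ} (hω : ω ^ 2 + ω + 1 = 0)
include hω

omit hr0 hr in
theorem cubeRoot_pow_three : ω ^ 3 = 1 := by linear_combination (ω - 1) * hω

omit hr0 hr in
theorem cubeRoot_ne_zero : ω ≠ 0 := fun h0 => by simp [h0] at hω

omit hr0 hr in
theorem cubeRoot_norm : ‖ω‖ = 1 :=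
  Complex.norm_eq_one_of_pow_eq_one (cubeRoot_pow_three hω) three_ne_zero

omit hr0 hr in
theorem cubeRoot_ne_one : ω ≠ 1 := fun h => by norm_num [h] at hω

omit hr in
theorem div_cubeRoot : r ^ 6 / (r ^ 3 * ω) = r ^ 3 * ω ^ 2 := by
  have := cubeRoot_ne_zero hω
  field_simp
  linear_combination -cubeRoot_pow_three hω

omit hr in
theorem div_cubeRoot_sq : r ^ 6 / (r ^ 3 * ω) ^ 2 = ω := by
  have := cubeRoot_ne_zero hω
  field_simp
  linear_combination -cubeRoot_pow_three hω

theorem lambertData_four : LambertData (r ^ 6) (r ^ 3 * ω) (-1) 1 0 where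
  q_ne_zero := pow_ne_zero 6 hr0
  norm_q := norm_pow_lt_one hr (by norm_num)
  a_ne_zero := mul_ne_zero (pow_ne_zero 3 hr0) (cubeRoot_ne_zero hω)
  norm_a := by
    rw [norm_mul, cubeRoot_norm hω, mul_one]
    exact norm_pow_lt_one hr (by norm_num)
  norm_q_div := by
    rw [div_cubeRoot hr0 hω, norm_mul, norm_mul, norm_pow ω, cubeRoot_norm hω, one_pow]
  sq_ne := by rw [div_cubeRoot_sq hr0 hω]; exact cubeRoot_ne_one hω
  b_ne_zero := by norm_num
  b_ne := (lambertData_zero hr0 hr).b_ne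
  b_sq := by norm_num
  c_eq := by norm_num
  theta_a := theta_pow_ne_zero hr0 hr (m := 3)
    (by rw [norm_mul, norm_pow, cubeRoot_norm hω, mul_one]) (by norm_num) (by norm_num)
  theta_b := theta_pow_ne_zero hr0 hr (m := 3)
    (by rw [mul_div_assoc, div_cubeRoot hr0 hω, norm_mul, norm_neg, norm_one, norm_mul, norm_pow,
          norm_pow, cubeRoot_norm hω, one_pow, one_mul, mul_one])
    (by norm_num) (by norm_num)

omit hr in
theorem mul_div_cubeRoot : -(r ^ 3)⁻¹ * r ^ 6 / (r ^ 3 * ω) = -ω ^ 2 := by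
  rw [mul_div_assoc, div_cubeRoot hr0 hω]
  field_simp

/-- The point `-ω²` has modulus 1, on the edge of the annulus where `theta_ne_zero_of_norm` applies.
Splitting off the first factor `1 + ω² = -ω` leaves products that are visibly nonzero. -/
theorem theta_neg_cubeRoot_sq :
    theta (-ω ^ 2) (r ^ 6) = -ω * qProd (ω ^ 2 * -r ^ 6) (r ^ 6) * qProd (ω * -r ^ 6) (r ^ 6) := by
  have h0 := cubeRoot_ne_zero hω
  have h3 := cubeRoot_pow_three hω
  have e : r ^ 6 / -ω ^ 2 = ω * -r ^ 6 := by
    field_simp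
    linear_combination h3
  rw [theta, e, qProd_succ _ (norm_pow_lt_one hr (m := 6) (by norm_num)),
    show -ω ^ 2 * r ^ 6 = ω ^ 2 * -r ^ 6 by ring, show 1 - -ω ^ 2 = -ω by linear_combination hω]

theorem theta_cubeRoot :
    theta ω (r ^ 6) = (1 - ω) * (qProd (ω * r ^ 6) (r ^ 6) * qProd (ω ^ 2 * r ^ 6) (r ^ 6)) := by
  have h0 := cubeRoot_ne_zero hω
  have h3 := cubeRoot_pow_three hω
  have e : r ^ 6 / ω = ω ^ 2 * r ^ 6 := by
    field_simp
    linear_combination -h3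
  rw [theta, e, qProd_succ _ (norm_pow_lt_one hr (m := 6) (by norm_num)), mul_assoc]

theorem lambertData_two : LambertData (r ^ 6) (r ^ 3 * ω) (-(r ^ 3)⁻¹) ω 1 where
  q_ne_zero := pow_ne_zero 6 hr0
  norm_q := norm_pow_lt_one hr (by norm_num)
  a_ne_zero := mul_ne_zero (pow_ne_zero 3 hr0) (cubeRoot_ne_zero hω)
  norm_a := (lambertData_four hr0 hr hω).norm_a
  norm_q_div := (lambertData_four hr0 hr hω).norm_q_div
  sq_ne := (lambertData_four hr0 hr hω).sq_ne
  b_ne_zero := (lambertData_six hr0 hr).b_ne_zero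
  b_ne := (lambertData_six hr0 hr).b_ne
  b_sq := (lambertData_six hr0 hr).b_sq
  c_eq := by
    rw [zpow_one]
    field_simp
  theta_a := (lambertData_four hr0 hr hω).theta_a
  theta_b := by
    have h6 : ‖r ^ 6‖ < 1 := norm_pow_lt_one hr (by norm_num)
    rw [mul_div_cubeRoot hr0 hω, theta_neg_cubeRoot_sq hr0 hr hω]
    refine mul_ne_zero (mul_ne_zero (neg_ne_zero.2 (cubeRoot_ne_zero hω))
      (qProd_ne_zero_of_norm_lt h6 ?_)) (qProd_ne_zero_of_norm_lt h6 ?_)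
    · rwa [norm_mul, norm_pow, cubeRoot_norm hω, one_pow, one_mul, norm_neg]
    · rwa [norm_mul, cubeRoot_norm hω, one_mul, norm_neg]

theorem const_four {M : ℂ} (hM : M = -(qProd (r ^ 12) (r ^ 12) /
    (qProd (r ^ 6) (r ^ 6) ^ 2 * qProd (r ^ 36) (r ^ 36)))) :
    M * ((r ^ 3)⁻¹ / (ω - ω ^ 2)) * (qProd (r ^ 6) (r ^ 6) ^ 2 *
        theta (r ^ 6 / (r ^ 3 * ω) ^ 2) (r ^ 6))
      = -(r ^ 3 * ω)⁻¹ * theta (r ^ 3 * ω) (r ^ 6) *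
        theta (-1 * r ^ 6 / (r ^ 3 * ω)) (r ^ 6) := by
  have h0 := cubeRoot_ne_zero hω
  have h3 := cubeRoot_pow_three hω
  have hd : 1 - ω ≠ 0 := sub_ne_zero.2 (cubeRoot_ne_one hω).symm
  have z1 : qProd (r ^ 6) (r ^ 6) ≠ 0 := qProd_pow_ne_zero hr (by norm_num) (by norm_num)
  have z2 : qProd (r ^ 36) (r ^ 36) ≠ 0 := qProd_pow_ne_zero hr (by norm_num) (by norm_num)
  have key := product_identity_cubic_even hω (p := r ^ 3) (norm_pow_lt_one hr (by norm_num))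
  simp only [← pow_mul] at key
  norm_num at key
  have e1 : theta (r ^ 3 * ω) (r ^ 6) = qProd (ω * r ^ 3) (r ^ 6) * qProd (ω ^ 2 * r ^ 3) (r ^ 6) := by
    rw [theta, div_cubeRoot hr0 hω, mul_comm, mul_comm (r ^ 3) (ω ^ 2), mul_comm (r ^ 3), mul_comm]
  have e2 : theta (-1 * r ^ 6 / (r ^ 3 * ω)) (r ^ 6)
      = qProd (-(ω ^ 2 * r ^ 3)) (r ^ 6) * qProd (-(ω * r ^ 3)) (r ^ 6) := by
    rw [mul_div_assoc, div_cubeRoot hr0 hω, theta,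
      show r ^ 6 / (-1 * (r ^ 3 * ω ^ 2)) = -(ω * r ^ 3) by
        field_simp
        linear_combination h3,
      show -1 * (r ^ 3 * ω ^ 2) = -(ω ^ 2 * r ^ 3) by ring]
  rw [div_cubeRoot_sq hr0 hω, theta_cubeRoot hr0 hr hω, e1, e2, hM,
    show ω - ω ^ 2 = ω * (1 - ω) by ring]
  generalize qProd (ω * r ^ 6) (r ^ 6) = x1 at key ⊢
  generalize qProd (ω ^ 2 * r ^ 6) (r ^ 6) = x2 at key ⊢
  generalize qProd (ω * r ^ 3) (r ^ 6) = x3 at key ⊢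
  generalize qProd (ω ^ 2 * r ^ 3) (r ^ 6) = x4 at key ⊢
  generalize qProd (-(ω * r ^ 3)) (r ^ 6) = x5 at key ⊢
  generalize qProd (-(ω ^ 2 * r ^ 3)) (r ^ 6) = x6 at key ⊢
  field_simp
  linear_combination -key

theorem const_two {M : ℂ} (hM : M = qProd (-r ^ 3) (-r ^ 3) /
    (qProd (r ^ 6) (r ^ 6) ^ 2 * qProd (-r ^ 9) (-r ^ 9))) :
    M * ((r ^ 3)⁻¹ * ω / (ω - ω ^ 2)) * (qProd (r ^ 6) (r ^ 6) ^ 2 *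
        theta (r ^ 6 / (r ^ 3 * ω) ^ 2) (r ^ 6))
      = -(r ^ 3 * ω)⁻¹ * theta (r ^ 3 * ω) (r ^ 6) *
        theta (-(r ^ 3)⁻¹ * r ^ 6 / (r ^ 3 * ω)) (r ^ 6) := by
  have h0 := cubeRoot_ne_zero hω
  have hd : 1 - ω ≠ 0 := sub_ne_zero.2 (cubeRoot_ne_one hω).symm
  have z1 : qProd (r ^ 6) (r ^ 6) ≠ 0 := qProd_pow_ne_zero hr (by norm_num) (by norm_num)
  have h9 : ‖-r ^ 9‖ < 1 := by rw [norm_neg]; exact norm_pow_lt_one hr (by norm_num)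
  have z2 : qProd (-r ^ 9) (-r ^ 9) ≠ 0 := qProd_ne_zero_of_norm_lt h9 h9
  have key := product_identity_cubic_odd hω (p := r ^ 3) (norm_pow_lt_one hr (by norm_num))
  simp only [← pow_mul, Nat.reduceMul] at key
  have e1 : theta (r ^ 3 * ω) (r ^ 6) = qProd (ω * r ^ 3) (r ^ 6) * qProd (ω ^ 2 * r ^ 3) (r ^ 6) := by
    rw [theta, div_cubeRoot hr0 hω, mul_comm, mul_comm (r ^ 3) (ω ^ 2), mul_comm (r ^ 3), mul_comm]
  rw [div_cubeRoot_sq hr0 hω, theta_cubeRoot hr0 hr hω, e1, mul_div_cubeRoot hr0 hω,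
    theta_neg_cubeRoot_sq hr0 hr hω, hM, show ω - ω ^ 2 = ω * (1 - ω) by ring]
  generalize qProd (ω * r ^ 6) (r ^ 6) = x1 at key ⊢
  generalize qProd (ω ^ 2 * r ^ 6) (r ^ 6) = x2 at key ⊢
  generalize qProd (ω * r ^ 3) (r ^ 6) = x3 at key ⊢
  generalize qProd (ω ^ 2 * r ^ 3) (r ^ 6) = x4 at key ⊢
  generalize qProd (ω * -r ^ 6) (r ^ 6) = x5 at key ⊢
  generalize qProd (ω ^ 2 * -r ^ 6) (r ^ 6) = x6 at key ⊢
  field_simp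
  linear_combination key

end Cubic

/-! ### Constants for σ = 0, 6, 3 -/

theorem const_zero {M : ℂ} (hM : M = -(qProd (r ^ 12) (r ^ 12) /
    (qProd (r ^ 6) (r ^ 6) ^ 2 * qProd (r ^ 4) (r ^ 4)))) :
    M * r⁻¹ * (qProd (r ^ 6) (r ^ 6) ^ 2 * theta (r ^ 6 / r ^ 2) (r ^ 6))
      = -r⁻¹ * theta r (r ^ 6) * theta (-1 * r ^ 6 / r) (r ^ 6) := by
  have z1 : qProd (r ^ 6) (r ^ 6) ≠ 0 := qProd_pow_ne_zero hr (by norm_num) (by norm_num)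
  have z2 : qProd (r ^ 4) (r ^ 4) ≠ 0 := qProd_pow_ne_zero hr (by norm_num) (by norm_num)
  have key := product_identity_quartic hr
  unfold theta
  rw [show r ^ 6 / r ^ 2 = r ^ 4 by field_simp, show r ^ 6 / r ^ 4 = r ^ 2 by field_simp,
    show -1 * r ^ 6 / r = -r ^ 5 by field_simp, show r ^ 6 / -r ^ 5 = -r by field_simp,
    show r ^ 6 / r = r ^ 5 by field_simp, hM]
  field_simp
  linear_combination -key

theorem const_six {M : ℂ} (hM : M = -(qProd (-r ^ 3) (-r ^ 3) /
    (qProd (r ^ 6) (r ^ 6) ^ 2 * qProd (-r) (-r)))) :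
    M * r⁻¹ * (qProd (r ^ 6) (r ^ 6) ^ 2 * theta (r ^ 6 / r ^ 2) (r ^ 6))
      = -r⁻¹ * theta r (r ^ 6) * theta (-(r ^ 3)⁻¹ * r ^ 6 / r) (r ^ 6) := by
  have z1 : qProd (r ^ 6) (r ^ 6) ≠ 0 := qProd_pow_ne_zero hr (by norm_num) (by norm_num)
  have hn : ‖-r‖ < 1 := by rwa [norm_neg]
  have z2 : qProd (-r) (-r) ≠ 0 := qProd_ne_zero_of_norm_lt hn hn
  -- The identity is used at `-r`, which produces the bases `-r` and `-r³` of `C6`.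
  have key := product_identity_sextic hn
  rw [show (-r) ^ 3 = -r ^ 3 by ring, show (-r) ^ 4 = r ^ 4 by ring, show (-r) ^ 2 = r ^ 2 by ring,
    show (-r) ^ 6 = r ^ 6 by ring, show (-r) ^ 5 = -r ^ 5 by ring, neg_neg, neg_neg] at key
  unfold theta
  rw [show r ^ 6 / r ^ 2 = r ^ 4 by field_simp, show r ^ 6 / r ^ 4 = r ^ 2 by field_simp,
    show -(r ^ 3)⁻¹ * r ^ 6 / r = -r ^ 2 by field_simp,
    show r ^ 6 / -r ^ 2 = -r ^ 4 by field_simp,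
    show r ^ 6 / r = r ^ 5 by field_simp, hM]
  field_simp
  linear_combination -key

theorem const_three {M : ℂ} (hM : M = qProd (r ^ 3) (r ^ 3) /
    (qProd (r ^ 6) (r ^ 6) ^ 2 * qProd r r)) :
    M * (r ^ 2)⁻¹ * (qProd (r ^ 6) (r ^ 6) ^ 2 * theta (r ^ 6 / (-r ^ 2) ^ 2) (r ^ 6))
      = -(-r ^ 2)⁻¹ * theta (-r ^ 2) (r ^ 6) * theta ((r ^ 3)⁻¹ * r ^ 6 / -r ^ 2) (r ^ 6) := by
  have z1 : qProd (r ^ 6) (r ^ 6) ≠ 0 := qProd_pow_ne_zero hr (by norm_num) (by norm_num)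
  have z2 : qProd r r ≠ 0 := qProd_ne_zero_of_norm_lt hr hr
  have key := product_identity_sextic hr
  unfold theta
  rw [show r ^ 6 / (-r ^ 2) ^ 2 = r ^ 2 by field_simp, show r ^ 6 / r ^ 2 = r ^ 4 by field_simp,
    show (r ^ 3)⁻¹ * r ^ 6 / -r ^ 2 = -r by field_simp,
    show r ^ 6 / -r ^ 2 = -r ^ 4 by field_simp,
    show r ^ 6 / -r = -r ^ 5 by field_simp, hM]
  field_simp
  linear_combination key

end Nome

/-! ### Powers of the nome and coefficients -/

theorem pPow_eq_zpow (τ : UpperHalfPlane) {l : ℂ} (m : ℤ) (h : l * 3 = m) :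
    pPow τ l = pPow τ (1 / 3) ^ m := by
  rw [pPow, pPow, ← Complex.exp_int_mul, ← h]
  congr 1
  ring

theorem pPow_eq_pow (τ : UpperHalfPlane) {l : ℂ} (m : ℕ) (h : l * 3 = m) :
    pPow τ l = pPow τ (1 / 3) ^ m := by
  rw [pPow_eq_zpow τ (m : ℤ) (by rw [h]; norm_cast), zpow_natCast]

theorem pPow_ne_zero (τ : UpperHalfPlane) (l : ℂ) : pPow τ l ≠ 0 := Complex.exp_ne_zero _

theorem norm_pPow_third_lt_one (τ : UpperHalfPlane) : ‖pPow τ (1 / 3)‖ < 1 := by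
  rw [pPow, Complex.norm_exp, Real.exp_lt_one_iff]
  have h := mul_pos Real.pi_pos τ.im_pos
  have e : Complex.I * Real.pi * (τ : ℂ) * (1 / 3)
      = ((Real.pi / 3 : ℝ) : ℂ) * (Complex.I * (τ : ℂ)) := by
    push_cast; ring
  rw [e, Complex.re_ofReal_mul, Complex.I_mul_re]
  have : (τ : ℂ).im = τ.im := rfl
  rw [this]
  linarith

section Coeff

variable (τ : UpperHalfPlane) (k : ℤ)

theorem coeff0_eq : coeff0 τ k =
    (pPow τ (1 / 3))⁻¹ * lambert (pPow τ (1 / 3) ^ 6) (pPow τ (1 / 3)) (-1) 1 k := by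
  rw [coeff0, pPow_eq_zpow τ (l := 4 * k / 3) (4 * k) (by push_cast; ring),
    pPow_eq_zpow τ (l := 2 * k) (6 * k) (by push_cast; ring),
    pPow_eq_zpow τ (l := (k - 1) / 3) (k - 1) (by push_cast; ring)]
  have hr := pPow_ne_zero τ (1 / 3)
  set r := pPow τ (1 / 3)
  have hk := zpow_ne_zero k hr
  rw [lambert, div_zpow, pow_zpow_swap, zpow_sub_one₀ hr, zpow_mul' r 4, zpow_mul' r 6]
  generalize r ^ k = X at hk ⊢
  simp only [zpow_ofNat, neg_mul, one_mul, sub_neg_eq_add]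
  field_simp

theorem coeff6_eq : coeff6 τ k = (pPow τ (1 / 3))⁻¹ *
    lambert (pPow τ (1 / 3) ^ 6) (pPow τ (1 / 3)) (-(pPow τ (1 / 3) ^ 3)⁻¹)
      (pPow τ (1 / 3) ^ 2)⁻¹ k := by
  rw [coeff6, pPow_eq_zpow τ (l := (4 * k - 2) / 3) (4 * k - 2) (by push_cast; ring),
    pPow_eq_zpow τ (l := 2 * k - 1) (6 * k - 3) (by push_cast; ring),
    pPow_eq_zpow τ (l := (k - 1) / 3) (k - 1) (by push_cast; ring)]
  have hr := pPow_ne_zero τ (1 / 3)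
  set r := pPow τ (1 / 3)
  have hk := zpow_ne_zero k hr
  rw [lambert, div_zpow, pow_zpow_swap, zpow_sub_one₀ hr, zpow_sub₀ hr, zpow_sub₀ hr,
    zpow_mul' r 4, zpow_mul' r 6]
  generalize r ^ k = X at hk ⊢
  simp only [zpow_ofNat, neg_mul, sub_neg_eq_add]
  field_simp

theorem coeff3_eq : coeff3 τ k = (pPow τ (1 / 3) ^ 2)⁻¹ *
    lambert (pPow τ (1 / 3) ^ 6) (-pPow τ (1 / 3) ^ 2) (pPow τ (1 / 3) ^ 3)⁻¹
      (pPow τ (1 / 3))⁻¹ k := by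
  rw [coeff3, pPow_eq_zpow τ (l := (2 * k - 1) / 3) (2 * k - 1) (by push_cast; ring),
    pPow_eq_zpow τ (l := 2 * k - 1) (6 * k - 3) (by push_cast; ring),
    pPow_eq_zpow τ (l := (2 * k - 2) / 3) (2 * k - 2) (by push_cast; ring)]
  have hr := pPow_ne_zero τ (1 / 3)
  set r := pPow τ (1 / 3)
  have hk := zpow_ne_zero k hr
  rw [lambert, show r ^ 6 / -r ^ 2 = -1 * r ^ 4 by field_simp, neg_eq_neg_one_mul (r ^ 2), mul_zpow,
    mul_zpow, pow_zpow_swap, pow_zpow_swap, pow_zpow_swap, zpow_sub₀ hr, zpow_sub₀ hr, zpow_sub₀ hr,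
    zpow_mul' r 2, zpow_mul' r 6]
  generalize r ^ k = X at hk ⊢
  simp only [zpow_ofNat]
  field_simp

variable {ω : ℂ} (hω : ω ^ 2 + ω + 1 = 0)
include hω

/-- The symbol is the odd character modulo 3, hence a combination of `ω^k` and `ω^{2k}`. These
powers become the two numerator terms `a^k` and `(q/a)^k` for `a = r³ω`. -/
theorem leg3_eq : leg3 k = (ω ^ k - (ω ^ 2) ^ k) / (ω - ω ^ 2) := by
  have h0 := cubeRoot_ne_zero hω
  have h3 := cubeRoot_pow_three hω
  have hd : 1 - ω ≠ 0 := sub_ne_zero.2 (cubeRoot_ne_one hω).symm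
  have hd' : ω - ω ^ 2 ≠ 0 := by
    rw [show ω - ω ^ 2 = ω * (1 - ω) by ring]
    exact mul_ne_zero h0 hd
  have hz : ∀ m : ℤ, ω ^ m = ω ^ (m % 3) := fun m => by
    conv_lhs => rw [← Int.emod_add_mul_ediv m 3]
    rw [zpow_add₀ h0, zpow_mul, show ω ^ (3 : ℤ) = 1 by exact_mod_cast h3, one_zpow, mul_one]
  rw [pow_zpow_swap, hz, leg3, legendreSym.mod]
  have : k % 3 = 0 ∨ k % 3 = 1 ∨ k % 3 = 2 := by omega
  rcases this with h | h | h <;> rw [Nat.cast_ofNat, h]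
  · rw [legendreSym.at_zero]; simp
  · rw [legendreSym.at_one, eq_div_iff hd']; simp
  · rw [show legendreSym 3 2 = -1 by decide, eq_div_iff hd']
    push_cast
    simp only [zpow_ofNat]
    linear_combination ω * h3

theorem coeff4_eq : coeff4 τ k = (pPow τ (1 / 3) ^ 3)⁻¹ / (ω - ω ^ 2) *
    lambert (pPow τ (1 / 3) ^ 6) (pPow τ (1 / 3) ^ 3 * ω) (-1) 1 k := by
  have hr := pPow_ne_zero τ (1 / 3)
  rw [coeff4, leg3_eq k hω, pPow_eq_zpow τ (l := 2 * k) (6 * k) (by push_cast; ring),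
    pPow_eq_zpow τ (l := k - 1) (3 * k - 3) (by push_cast; ring), lambert, div_cubeRoot hr hω,
    mul_zpow, mul_zpow, pow_zpow_swap _ 3, pow_zpow_swap _ 6, zpow_sub₀ hr, zpow_mul' _ 3, zpow_mul' _ 6]
  simp only [zpow_ofNat, neg_mul, one_mul, sub_neg_eq_add]
  ring

theorem coeff2_eq : coeff2 τ k = (pPow τ (1 / 3) ^ 3)⁻¹ * ω / (ω - ω ^ 2) *
    lambert (pPow τ (1 / 3) ^ 6) (pPow τ (1 / 3) ^ 3 * ω) (-(pPow τ (1 / 3) ^ 3)⁻¹) ω k := by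
  have hr := pPow_ne_zero τ (1 / 3)
  have h0 := cubeRoot_ne_zero hω
  rw [coeff2, leg3_eq (k + 1) hω, pPow_eq_zpow τ (l := 2 * k - 1) (6 * k - 3) (by push_cast; ring),
    pPow_eq_zpow τ (l := k - 1) (3 * k - 3) (by push_cast; ring), lambert, div_cubeRoot hr hω,
    mul_zpow, mul_zpow, pow_zpow_swap _ 3, pow_zpow_swap _ 6, zpow_sub₀ hr, zpow_sub₀ hr,
    zpow_mul' _ 3, zpow_mul' _ 6, zpow_add_one₀ h0, zpow_add_one₀ (pow_ne_zero 2 h0)]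
  simp only [zpow_ofNat]
  have e : (1 + (pPow τ (1 / 3) ^ k) ^ 6 / pPow τ (1 / 3) ^ 3) =
    (1 - -(pPow τ (1 / 3) ^ 3)⁻¹ * (pPow τ (1 / 3) ^ k) ^ 6) := by ring
  rw [e]
  ring

end Coeff

/-! ### Matrix entries -/

section Entries

variable {r t : ℂ} (hr0 : r ≠ 0) (hr : ‖r‖ < 1) (ht1 : ‖r‖ < ‖t‖) (ht2 : ‖r‖ * ‖t‖ < 1)
include hr0 hr ht1 ht2

omit ht2 in
theorem theta_neg_shift :
    theta (-1 * r ^ 6 * t) (r ^ 6) = t⁻¹ * theta (-t) (r ^ 6) := by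
  have ht : t ≠ 0 := norm_pos_iff.1 ((norm_nonneg _).trans_lt ht1)
  rw [show -1 * r ^ 6 * t = r ^ 6 * -t by ring,
    theta_mul_self (norm_pow_lt_one hr (by norm_num)) (pow_ne_zero 6 hr0) (neg_ne_zero.2 ht), inv_neg,
    neg_neg]

/-- Passing from nome `r²` to `r⁶` splits `θ(rt; r²)` into theta functions at `rt`, `r³t`, `r⁵t`.
The middle one cancels `θ(pt; p²)`; the outer two are the denominator for `a = r`. -/
theorem entry_ratio_cubic_base (N : ℂ) :
    N * theta (r ^ 3 * t) (r ^ 6) / theta (r * t) (r ^ 2) *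
      (theta (r * t) (r ^ 6) * theta (r ^ 6 / r * t) (r ^ 6)) = N := by
  have ht : t ≠ 0 := norm_pos_iff.1 ((norm_nonneg _).trans_lt ht1)
  have h1 := theta_mul_ne_zero hr0 hr (d := r) (m := 1) (by simp) (by norm_num) (by norm_num) ht1 ht2
  have h3 := theta_mul_ne_zero hr0 hr (d := r ^ 3) (m := 3) (by simp) (by norm_num) (by norm_num) ht1 ht2
  have h5 := theta_mul_ne_zero hr0 hr (d := r ^ 5) (m := 5) (by simp) (by norm_num) (by norm_num) ht1 ht2
  have e := theta_cubic_base (pow_ne_zero 2 hr0) (norm_pow_lt_one hr two_ne_zero) (mul_ne_zero hr0 ht)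
  rw [show (r ^ 2) ^ 3 = r ^ 6 by ring, show r ^ 2 * (r * t) = r ^ 3 * t by ring,
    show (r ^ 2) ^ 2 * (r * t) = r ^ 5 * t by ring] at e
  rw [e, show r ^ 6 / r = r ^ 5 by field_simp]
  field_simp

/-- Here the denominator splits over the cube roots of unity. The root 1 cancels against the
numerator, and the other two give `a = r³ω` and `q/a = r³ω²`. -/
theorem entry_ratio_cube {ω : ℂ} (hω : ω ^ 2 + ω + 1 = 0) (N : ℂ) :
    N * theta (r ^ 3 * t) (r ^ 6) / theta ((r ^ 3 * t) ^ 3) (r ^ 18) *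
      (theta (r ^ 3 * ω * t) (r ^ 6) * theta (r ^ 6 / (r ^ 3 * ω) * t) (r ^ 6)) = N := by
  have ht : t ≠ 0 := norm_pos_iff.1 ((norm_nonneg _).trans_lt ht1)
  have hω1 := cubeRoot_norm hω
  have h1 := theta_mul_ne_zero hr0 hr (d := r ^ 3) (m := 3) (by simp) (by norm_num) (by norm_num) ht1 ht2
  have h2 := theta_mul_ne_zero hr0 hr (d := r ^ 3 * ω) (m := 3) (by simp [hω1]) (by norm_num)
    (by norm_num) ht1 ht2
  have h3 := theta_mul_ne_zero hr0 hr (d := r ^ 3 * ω ^ 2) (m := 3) (by simp [hω1]) (by norm_num)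
    (by norm_num) ht1 ht2
  have e := theta_cube hω (norm_pow_lt_one hr (m := 6) (by norm_num))
    (mul_ne_zero (pow_ne_zero 3 hr0) ht)
  rw [show (r ^ 6) ^ 3 = r ^ 18 by ring, show ω * (r ^ 3 * t) = r ^ 3 * ω * t by ring,
    show ω ^ 2 * (r ^ 3 * t) = r ^ 3 * ω ^ 2 * t by ring] at e
  rw [e, div_cubeRoot hr0 hω]
  generalize theta (r ^ 3 * t) (r ^ 6) = x at h1 ⊢
  generalize theta (r ^ 3 * ω * t) (r ^ 6) = y at h2 ⊢
  generalize theta (r ^ 3 * ω ^ 2 * t) (r ^ 6) = w at h3 ⊢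
  field_simp

omit ht2 in
theorem entry_ratio_neg (N : ℂ) (hne : theta (-t) (r ^ 2) ≠ 0) :
    N * theta (-t) (r ^ 6) / theta (-t) (r ^ 2) *
      (theta (-r ^ 2 * t) (r ^ 6) * theta (r ^ 6 / -r ^ 2 * t) (r ^ 6)) = N := by
  have ht : t ≠ 0 := norm_pos_iff.1 ((norm_nonneg _).trans_lt ht1)
  have e := theta_cubic_base (pow_ne_zero 2 hr0) (norm_pow_lt_one hr two_ne_zero) (neg_ne_zero.2 ht)
  rw [show (r ^ 2) ^ 3 = r ^ 6 by ring, show r ^ 2 * -t = -r ^ 2 * t by ring,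
    show (r ^ 2) ^ 2 * -t = -r ^ 4 * t by ring] at e
  rw [show r ^ 6 / -r ^ 2 = -r ^ 4 by field_simp, div_mul_eq_mul_div, div_eq_iff hne, e]
  ring

end Entries

theorem prodLT_ne_zero {m : ℕ} {f : Fin m → Fin m → ℂ} (h : prodLT f ≠ 0) {i j : Fin m}
    (hij : i < j) : f i j ≠ 0 := by
  have h1 := Finset.prod_ne_zero_iff.1 h i (Finset.mem_univ i)
  exact Finset.prod_ne_zero_iff.1 h1 j (Finset.mem_Ioi.2 hij)

theorem pref3_ne_zero {n : ℕ} {z : Fin (2 * n) → ℂ} {τ : UpperHalfPlane} (h : pref3 z τ ≠ 0)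
    {i j : Fin (2 * n)} (hij : i ≠ j) :
    theta (-(xVar z i ^ 2 / xVar z j ^ 2)) (pPow τ (2 / 3)) ≠ 0 := by
  have h2 : ‖pPow τ (2 / 3)‖ < 1 := by
    rw [pPow_eq_pow τ 2 (by norm_num)]
    exact norm_pow_lt_one (norm_pPow_third_lt_one τ) two_ne_zero
  have hne : ∀ i j : Fin (2 * n), i < j →
      theta (-(xVar z i ^ 2 / xVar z j ^ 2)) (pPow τ (2 / 3)) ≠ 0 := fun i j hij =>
    right_ne_zero_of_mul (prodLT_ne_zero h hij)
  rcases lt_or_gt_of_ne hij with h1 | h1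
  · exact hne i j h1
  -- The prefactor only contains the pairs `i < j`; the inversion formula for `θ` supplies the
  -- others.
  · have h3 := hne j i h1
    have hx : ∀ l, xVar z l ^ 2 ≠ 0 := fun l => pow_ne_zero 2 (xVar_ne_zero z l)
    have ht : -(xVar z j ^ 2 / xVar z i ^ 2) ≠ 0 := neg_ne_zero.2 (div_ne_zero (hx j) (hx i))
    rw [show -(xVar z i ^ 2 / xVar z j ^ 2) = (-(xVar z j ^ 2 / xVar z i ^ 2))⁻¹ by
      rw [inv_neg, inv_div], theta_inv h2 (pPow_ne_zero _ _) ht]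
    exact mul_ne_zero (neg_ne_zero.2 (inv_ne_zero ht)) h3

/-! ### The expansions -/

section Expansions

variable {n : ℕ} {τ : UpperHalfPlane} {z : Fin (2 * n) → ℂ}
  (hz : ∀ i j, ‖pPow τ (1 / 3)‖ * ‖xVar z j ^ 2‖ < ‖xVar z i ^ 2‖)
include hz

theorem ratio_bounds (i j : Fin (2 * n)) :
    ‖pPow τ (1 / 3)‖ < ‖xVar z i ^ 2 / xVar z j ^ 2‖ ∧
      ‖pPow τ (1 / 3)‖ * ‖xVar z i ^ 2 / xVar z j ^ 2‖ < 1 := by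
  have hjn := norm_pos_iff.2 (pow_ne_zero 2 (xVar_ne_zero z j))
  rw [norm_div]
  refine ⟨(lt_div_iff₀ hjn).2 (hz i j), ?_⟩
  rw [← mul_div_assoc, div_lt_one hjn]
  exact hz j i

theorem bounds_of_norm_le {a : ℂ} (ha : ‖a‖ ≤ ‖pPow τ (1 / 3)‖) (i j : Fin (2 * n)) :
    ‖a‖ * ‖xVar z j ^ 2‖ < ‖xVar z i ^ 2‖ :=
  (mul_le_mul_of_nonneg_right ha (norm_nonneg _)).trans_lt (hz i j)

theorem expansion_P0 : Summable (term (coeff0 τ) 0 z) ∧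
    P0 z τ = C0 τ ^ n * pref06 z τ * ∑' k : IncTuple n, term (coeff0 τ) 0 z k := by
  have hr0 := pPow_ne_zero τ (1 / 3)
  have hr := norm_pPow_third_lt_one τ
  have key := (lambertData_zero hr0 hr).prefactor_mul_pfaffian (n := n) (Or.inl rfl)
    (const_zero hr0 hr (M := C0 τ) (by
      rw [C0, pPow_eq_pow τ (l := 4) 12 (by norm_num), pPow_eq_pow τ (l := 2) 6 (by norm_num),
        pPow_eq_pow τ (l := 4 / 3) 4 (by norm_num)])) (coeff0_eq τ) hz (F := pref06 z τ) (w := fun _ => 1)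
    (A := fun i j => xVar z j ^ 2 * num034 z τ i j /
      (xVar z i ^ 2 * theta (pPow τ (1 / 3) * xVar z i ^ 2 / xVar z j ^ 2) (pPow τ (2 / 3))))
    fun _ i j _ => by
      obtain ⟨h1, h2⟩ := ratio_bounds hz i j
      have hi := xVar_ne_zero z i
      have hj := xVar_ne_zero z j
      have e := entry_ratio_cubic_base hr0 hr h1 h2
        (theta (xVar z i ^ 2 / xVar z j ^ 2) (pPow τ (1 / 3) ^ 6) *
          theta (-(xVar z i ^ 2 / xVar z j ^ 2)) (pPow τ (1 / 3) ^ 6))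
      -- For `s = 0`, `θ(bqt) = θ(-qt) = t⁻¹ θ(-t)`, and this `t⁻¹` is the monomial `x_j²/x_i²` of
      -- the entry. No rescaling is needed, so `w = 1`.
      rw [theta_neg_shift hr0 hr h1, num034, pPow_eq_pow τ (l := 2) 6 (by norm_num),
        pPow_eq_pow τ (l := 1) 3 (by norm_num), pPow_eq_pow τ (l := 2 / 3) 2 (by norm_num),
        mul_div_assoc (pPow τ (1 / 3) ^ 3), mul_div_assoc (pPow τ (1 / 3)), zpow_zero, inv_one, mul_div_mul_comm, inv_div]
      linear_combination (xVar z j ^ 2 / xVar z i ^ 2) * e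
  refine ⟨key.1, ?_⟩
  rw [P0, key.2]
  simp

theorem expansion_P6 : Summable (term (coeff6 τ) 1 z) ∧
    P6 z τ = C6 τ ^ n * (∏ j, xVar z j) * pref06 z τ *
      ∑' k : IncTuple n, term (coeff6 τ) 1 z k := by
  have hr0 := pPow_ne_zero τ (1 / 3)
  have hr := norm_pPow_third_lt_one τ
  refine (lambertData_six hr0 hr).prefactor_mul_pfaffian (n := n) (Or.inr rfl)
    (const_six hr0 hr (M := C6 τ) (by
      rw [C6, pPow_eq_pow τ (l := 1) 3 (by norm_num), pPow_eq_pow τ (l := 2) 6 (by norm_num)])) (coeff6_eq τ) hz fun _ i j _ => ?_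
  obtain ⟨h1, h2⟩ := ratio_bounds hz i j
  have hi := xVar_ne_zero z i
  have hj := xVar_ne_zero z j
  have e := entry_ratio_cubic_base hr0 hr h1 h2
    (theta (xVar z i ^ 2 / xVar z j ^ 2) (pPow τ (1 / 3) ^ 6) *
      theta (-(pPow τ (1 / 3) ^ 3 * (xVar z i ^ 2 / xVar z j ^ 2))) (pPow τ (1 / 3) ^ 6))
  -- For `s = 1` the monomial is a rescaling by `x_i x_j` times the `(x_i²)⁻¹` left by folding; the
  -- rescaling produces the factor `X`.
  have e2 : xVar z j / xVar z i = xVar z i * xVar z j * (xVar z i ^ 2)⁻¹ := by field_simp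
  rw [num26, pPow_eq_pow τ (l := 2) 6 (by norm_num),
    pPow_eq_pow τ (l := 1) 3 (by norm_num), pPow_eq_pow τ (l := 2 / 3) 2 (by norm_num),
    mul_div_assoc (pPow τ (1 / 3) ^ 3), mul_div_assoc (pPow τ (1 / 3)), zpow_one, mul_div_mul_comm, ← e2,
    show -(pPow τ (1 / 3) ^ 3)⁻¹ * pPow τ (1 / 3) ^ 6 * (xVar z i ^ 2 / xVar z j ^ 2)
      = -(pPow τ (1 / 3) ^ 3 * (xVar z i ^ 2 / xVar z j ^ 2)) by field_simp]
  linear_combination (xVar z j / xVar z i) * e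

theorem expansion_P3 : Summable (term (coeff3 τ) 1 z) ∧
    P3 z τ = C3 τ ^ n * (∏ j, xVar z j) * pref3 z τ *
      ∑' k : IncTuple n, term (coeff3 τ) 1 z k := by
  have hr0 := pPow_ne_zero τ (1 / 3)
  have hr := norm_pPow_third_lt_one τ
  refine (lambertData_three hr0 hr).prefactor_mul_pfaffian (n := n) (Or.inr rfl)
    (const_three hr0 hr (M := C3 τ) (by
      rw [C3, pPow_eq_pow τ (l := 1) 3 (by norm_num), pPow_eq_pow τ (l := 2) 6 (by norm_num)])) (coeff3_eq τ) (bounds_of_norm_le hz ?_) fun hF i j hij => ?_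
  · rw [norm_neg, norm_pow]
    exact pow_le_of_le_one (norm_nonneg _) hr.le two_ne_zero
  obtain ⟨h1, h2⟩ := ratio_bounds hz i j
  have hi := xVar_ne_zero z i
  have hj := xVar_ne_zero z j
  have hne := pref3_ne_zero hF hij
  rw [pPow_eq_pow τ (l := 2 / 3) 2 (by norm_num)] at hne
  have e := entry_ratio_neg hr0 hr h1
    (theta (xVar z i ^ 2 / xVar z j ^ 2) (pPow τ (1 / 3) ^ 6) *
      theta (pPow τ (1 / 3) ^ 3 * (xVar z i ^ 2 / xVar z j ^ 2)) (pPow τ (1 / 3) ^ 6)) hne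
  have e2 : xVar z j / xVar z i = xVar z i * xVar z j * (xVar z i ^ 2)⁻¹ := by field_simp
  rw [num034, pPow_eq_pow τ (l := 2) 6 (by norm_num),
    pPow_eq_pow τ (l := 1) 3 (by norm_num), pPow_eq_pow τ (l := 2 / 3) 2 (by norm_num),
    mul_div_assoc (pPow τ (1 / 3) ^ 3), zpow_one, mul_div_mul_comm, ← e2,
    show (pPow τ (1 / 3) ^ 3)⁻¹ * pPow τ (1 / 3) ^ 6 * (xVar z i ^ 2 / xVar z j ^ 2)
      = pPow τ (1 / 3) ^ 3 * (xVar z i ^ 2 / xVar z j ^ 2) by field_simp]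
  linear_combination (xVar z j / xVar z i) * e

theorem expansion_P4 {ω : ℂ} (hω : ω ^ 2 + ω + 1 = 0) : Summable (term (coeff4 τ) 0 z) ∧
    P4 z τ = C4 τ ^ n * pref24 z τ * ∑' k : IncTuple n, term (coeff4 τ) 0 z k := by
  have hr0 := pPow_ne_zero τ (1 / 3)
  have hr := norm_pPow_third_lt_one τ
  have key := (lambertData_four hr0 hr hω).prefactor_mul_pfaffian (n := n) (Or.inl rfl)
    (const_four hr0 hr hω (M := C4 τ) (by
      rw [C4, pPow_eq_pow τ (l := 4) 12 (by norm_num), pPow_eq_pow τ (l := 2) 6 (by norm_num),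
        pPow_eq_pow τ (l := 12) 36 (by norm_num)])) (fun k => coeff4_eq τ k hω) (bounds_of_norm_le hz (by
      rw [norm_mul, cubeRoot_norm hω, mul_one, norm_pow]
      exact pow_le_of_le_one (norm_nonneg _) hr.le three_ne_zero)) (F := pref24 z τ)
    (w := fun _ => 1)
    (A := fun i j => xVar z j ^ 2 * num034 z τ i j /
      (xVar z i ^ 2 * theta (pPow τ 3 * xVar z i ^ 6 / xVar z j ^ 6) (pPow τ 6)))
    fun _ i j _ => by
      obtain ⟨h1, h2⟩ := ratio_bounds hz i j
      have e := entry_ratio_cube hr0 hr h1 h2 hω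
        (theta (xVar z i ^ 2 / xVar z j ^ 2) (pPow τ (1 / 3) ^ 6) *
          theta (-(xVar z i ^ 2 / xVar z j ^ 2)) (pPow τ (1 / 3) ^ 6))
      rw [theta_neg_shift hr0 hr h1, num034, pPow_eq_pow τ (l := 2) 6 (by norm_num),
        pPow_eq_pow τ (l := 1) 3 (by norm_num), pPow_eq_pow τ (l := 3) 9 (by norm_num),
        pPow_eq_pow τ (l := 6) 18 (by norm_num),
        show pPow τ (1 / 3) ^ 9 * xVar z i ^ 6 / xVar z j ^ 6
          = (pPow τ (1 / 3) ^ 3 * (xVar z i ^ 2 / xVar z j ^ 2)) ^ 3 by ring,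
        mul_div_assoc (pPow τ (1 / 3) ^ 3), zpow_zero, inv_one, mul_div_mul_comm, inv_div]
      linear_combination (xVar z j ^ 2 / xVar z i ^ 2) * e
  refine ⟨key.1, ?_⟩
  rw [P4, key.2]
  simp

theorem expansion_P2 {ω : ℂ} (hω : ω ^ 2 + ω + 1 = 0) : Summable (term (coeff2 τ) 1 z) ∧
    P2 z τ = C2 τ ^ n * (∏ j, xVar z j) * pref24 z τ *
      ∑' k : IncTuple n, term (coeff2 τ) 1 z k := by
  have hr0 := pPow_ne_zero τ (1 / 3)
  have hr := norm_pPow_third_lt_one τ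
  refine (lambertData_two hr0 hr hω).prefactor_mul_pfaffian (n := n) (Or.inr rfl)
    (const_two hr0 hr hω (M := C2 τ) (by
      rw [C2, pPow_eq_pow τ (l := 1) 3 (by norm_num), pPow_eq_pow τ (l := 2) 6 (by norm_num),
        pPow_eq_pow τ (l := 3) 9 (by norm_num)])) (fun k => coeff2_eq τ k hω) (bounds_of_norm_le hz ?_)
    fun _ i j _ => ?_
  · rw [norm_mul, cubeRoot_norm hω, mul_one, norm_pow]
    exact pow_le_of_le_one (norm_nonneg _) hr.le three_ne_zero
  obtain ⟨h1, h2⟩ := ratio_bounds hz i j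
  have hi := xVar_ne_zero z i
  have hj := xVar_ne_zero z j
  have e := entry_ratio_cube hr0 hr h1 h2 hω
    (theta (xVar z i ^ 2 / xVar z j ^ 2) (pPow τ (1 / 3) ^ 6) *
      theta (-(pPow τ (1 / 3) ^ 3 * (xVar z i ^ 2 / xVar z j ^ 2))) (pPow τ (1 / 3) ^ 6))
  have e2 : xVar z j / xVar z i = xVar z i * xVar z j * (xVar z i ^ 2)⁻¹ := by field_simp
  rw [num26, pPow_eq_pow τ (l := 2) 6 (by norm_num),
    pPow_eq_pow τ (l := 1) 3 (by norm_num), pPow_eq_pow τ (l := 3) 9 (by norm_num),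
    pPow_eq_pow τ (l := 6) 18 (by norm_num),
    show pPow τ (1 / 3) ^ 9 * xVar z i ^ 6 / xVar z j ^ 6
      = (pPow τ (1 / 3) ^ 3 * (xVar z i ^ 2 / xVar z j ^ 2)) ^ 3 by ring,
    mul_div_assoc (pPow τ (1 / 3) ^ 3), zpow_one, mul_div_mul_comm, ← e2,
    show -(pPow τ (1 / 3) ^ 3)⁻¹ * pPow τ (1 / 3) ^ 6 * (xVar z i ^ 2 / xVar z j ^ 2)
      = -(pPow τ (1 / 3) ^ 3 * (xVar z i ^ 2 / xVar z j ^ 2)) by field_simp]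
  linear_combination (xVar z j / xVar z i) * e

end Expansions

theorem exists_cubeRoot : ∃ ω : ℂ, ω ^ 2 + ω + 1 = 0 := by
  have h3 : ((√3 : ℝ) : ℂ) ^ 2 = 3 := by
    rw [← Complex.ofReal_pow, Real.sq_sqrt (by norm_num)]
    norm_num
  refine ⟨(-1 + √3 * Complex.I) / 2, ?_⟩
  linear_combination (1 / 4) * h3 * Complex.I ^ 2 + (3 / 4) * Complex.I_sq

end EllipticPfaffian

/-! ### Assembly on a common neighbourhood of the torus -/

open EllipticPfaffian
theorem mainTheorem7 (n : ℕ) (hn : 1 ≤ n) (τ : UpperHalfPlane) :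
    ∃ U : Set (Fin (2 * n) → ℂ), IsOpen U ∧ {x | ∀ j, ‖x j‖ = 1} ⊆ U ∧
      ∀ z : Fin (2 * n) → ℂ, xVar z ∈ U →
        (Summable (term (coeff0 τ) 0 z) ∧
          P0 z τ = C0 τ ^ n * pref06 z τ * ∑' k : IncTuple n, term (coeff0 τ) 0 z k) ∧
        (Summable (term (coeff2 τ) 1 z) ∧
          P2 z τ = C2 τ ^ n * (∏ j, xVar z j) * pref24 z τ *
            ∑' k : IncTuple n, term (coeff2 τ) 1 z k) ∧
        (Summable (term (coeff3 τ) 1 z) ∧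
          P3 z τ = C3 τ ^ n * (∏ j, xVar z j) * pref3 z τ *
            ∑' k : IncTuple n, term (coeff3 τ) 1 z k) ∧
        (Summable (term (coeff4 τ) 0 z) ∧
          P4 z τ = C4 τ ^ n * pref24 z τ * ∑' k : IncTuple n, term (coeff4 τ) 0 z k) ∧
        (Summable (term (coeff6 τ) 1 z) ∧
          P6 z τ = C6 τ ^ n * (∏ j, xVar z j) * pref06 z τ *
            ∑' k : IncTuple n, term (coeff6 τ) 1 z k) := by
  obtain ⟨ω, hω⟩ := exists_cubeRoot
  -- The set says `|r| < |x_i²/x_j²| < 1/|r|` for all pairs. Since `|a| ≤ |r|` in all five cases, it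
  -- serves them all.
  refine ⟨{x | ∀ i j, ‖pPow τ (1 / 3)‖ * ‖x j ^ 2‖ < ‖x i ^ 2‖}, ?_, fun x hx i j => ?_,
    fun z hz => ⟨expansion_P0 hz, expansion_P2 hz hω, expansion_P3 hz, expansion_P4 hz hω,
      expansion_P6 hz⟩⟩
  · simp_rw [Set.ofPred_forall]
    exact isOpen_iInter_of_finite fun i => isOpen_iInter_of_finite fun j =>
      isOpen_lt (by fun_prop) (by fun_prop)
  · rw [norm_pow, norm_pow, hx i, hx j, one_pow, mul_one]
    exact norm_pPow_third_lt_one τ
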